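/- **Setting.** A piecewise-stationary bandit has $A\ge 1$ arms, horizon $T\ge 2$ and change-points $1=\nu_0<\nu_1<\dots<\nu_{N_T}<\nu_{N_T+1}=T+1$ with $N_T\ge 1$. In rounds $\nu_{k-1},\dots,\nu_k-1$ the rewards of arm $a$ are drawn, independently over time and arms, from a fixed $\sigma^2$-sub-Gaussian distribution with mean $\mu_{a,k}$. Assume $\max_{a'}\mu_{a',k}-\mu_{a,k}\le C$ for all $a,k$, and $\max_a|\mu_{a,k+1}-\mu_{a,k}|\ge\underline\Delta_{\rm c}>0$ for $k\le N_T$. The regret of a procedure playing arms $a_t$ is $R_T=\mathbb E\big[\sum_{k=1}^{N_T+1}\sum_{t=\nu_{k-1}}^{\nu_k-1}(\max_a\mu_{a,k}-\mu_{a_t,k})\big]$. **Bandit algorithm $\mathcal B$.** On every stationary $A$-armed instance with $\sigma^2$-sub-Gaussian rewards and suboptimality gaps at most $C$, its regret over $n\ge2$ rounds is at most $K_{\mathcal B}\sqrt{An\log n}$. **Change detector $\mathcal D$.** For a horizon $M\ge 2$ and levels $\delta_{\rm F},\delta_{\rm D}\in(0,1)$ it is a stopping rule $\tau$ on a sequence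 of real samples. Let $\mathbb P_\nu$ denote that the samples are independent with a $\sigma^2$-sub-Gaussian law $f_0$ before index $\nu$ and a $\sigma^2$-sub-Gaussian law $f_1$ from $\nu$ on ($\nu=\infty$: no change). Then (false alarms) $\mathbb P_\infty(\tau\le M)\le\delta_{\rm F}$ for all $f_0$. With a pre-change window $m=m(\Delta,M)$, the latency for mean shift $\Delta>0$ is the least $t\in\{1,\dots,M\}$ such that $\mathbb P_\nu(\tau\ge\nu+t)\le\delta_{\rm D}$ for all $\nu\in\{m+1,\dots,M-t\}$ and all $f_0,f_1$ whose means differ by $\Delta$. Let $d=d(\Delta,M)$ be the latency, or any upper bound on it. It is required that $m$ and $d$ (which may also depend on $\delta_{\rm F},\delta_{\rm D}$) are non-increasing in $\Delta$ and non-decreasing in $M$, and that $m+d\le K_{\mathcal D}(\Delta)\,\big(\log M+\log(1/\delta_{\rm F})+\log(1/\delta_{\rm D})\big)$. **DAB procedure.** It has exploration frequencies $\alpha_1,\alpha_2,\dots$; start with $\tau=0$, $k=1$ and empty histories. In round $t=1,\dots,T$: if $((t-\tau-1)\bmod\lceil A/\alpha_k\rceil)+1=a\le A$, play arm $a$ (forced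 exploration); otherwise play the arm that $\mathcal B$ chooses from its own history, and append the arm and its reward to that history. The reward is appended to the detector history of the played arm, in one of two variants: (F) only in forced-exploration rounds; (S) in every round. If $\mathcal D$, run on the detector history just extended, declares a change, set $\tau\leftarrow t$, $k\leftarrow k+1$ and empty all histories. **Statement.** Let $\alpha_0>0$, $\gamma>1$, and in variant (S) also $\gamma\ge2$. Run the DAB procedure with $\mathcal B$ and $\mathcal D$ as above, where $\mathcal D$ has horizon $T$ and $\delta_{\rm F}=\delta_{\rm D}=T^{-\gamma}$, and with $\alpha_k=\alpha_0\sqrt{kA\log T/T}$. Put $m_k=\lceil A/\alpha_k\rceil\,m(\underline\Delta_{\rm c},T)$ and $d_k=\lceil A/\alpha_k\rceil\,d(\underline\Delta_{\rm c},T)$ for $k\ge1$, and $d_0=0$. If $$d_{k-1}+m_k\le\nu_k-\nu_{k-1}\quad\text{for all }1\le k\le N_T,$$ then $R_T\le c\,\sqrt{A\,N_T\,T\log T}$, where $c$ depends only on $\sigma,C,\underline\Delta_{\rm c},\alpha_0,\gamma,K_{\mathcal B}$ and the function $K_{\mathcal D}$. -/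

import Mathlib

open MeasureTheory ProbabilityTheory
open scoped NNReal

noncomputable section

namespace DAB

/-! ### Distributions -/

/-- The mean of a probability distribution on `ℝ`. -/
def mean (P : ProbabilityMeasure ℝ) : ℝ := ∫ x, x ∂(P : Measure ℝ)

/-- `P` is `σ²`-sub-Gaussian: the cumulant generating function of the centred variable is at most
`σ² θ² / 2`. -/
def SubGaussian (σ : ℝ≥0) (P : ProbabilityMeasure ℝ) : Prop :=
  HasSubgaussianMGF (fun x : ℝ => x - mean P) (σ ^ 2) (P : Measure ℝ)

/-- Suboptimality gap of arm `a` when the arms have reward distributions `F`. -/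
def gap {A : ℕ} (F : Fin A → ProbabilityMeasure ℝ) (a : Fin A) : ℝ :=
  (⨆ b : Fin A, mean (F b)) - mean (F a)

/-- What is drawn in one round: a uniform seed in `[0,1]` (internal randomisation of the bandit
algorithm; a deterministic algorithm ignores it) and the rewards of all arms, of which only the
reward of the played arm is revealed. -/
abbrev Round (A : ℕ) : Type := unitInterval × (Fin A → ℝ)

/-- Law of one round when the arms have reward distributions `F`. -/
def roundLaw {A : ℕ} (F : Fin A → ProbabilityMeasure ℝ) : Measure (Round A) :=
  (volume : Measure unitInterval).prod (Measure.pi fun a => (F a : Measure ℝ))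

instance {A : ℕ} (F : Fin A → ProbabilityMeasure ℝ) : IsProbabilityMeasure (roundLaw F) := by
  unfold roundLaw; infer_instance

/-! ### Stationary bandit algorithms -/

/-- A (possibly randomised) bandit algorithm for `A` arms: it maps the history of plays and rewards
(oldest first) and a seed to the next arm. -/
structure BanditAlg (A : ℕ) where
  act : List (Fin A × ℝ) → unitInterval → Fin A
  measurable_act : ∀ n : ℕ,
    Measurable fun p : (Fin n → Fin A × ℝ) × unitInterval => act (List.ofFn p.1) p.2

/-- History after `n` rounds of the algorithm run alone. -/
def BanditAlg.hist {A : ℕ} (B : BanditAlg A) (ω : ℕ → Round A) : ℕ → List (Fin A × ℝ)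
  | 0 => []
  | n + 1 =>
    B.hist ω n ++ [(B.act (B.hist ω n) (ω n).1, (ω n).2 (B.act (B.hist ω n) (ω n).1))]

/-- Expected regret over `n` rounds on the stationary instance with reward distributions `F`. -/
def BanditAlg.regret {A : ℕ} (B : BanditAlg A) (F : Fin A → ProbabilityMeasure ℝ) (n : ℕ) : ℝ :=
  ∫ ω, ∑ i ∈ Finset.range n, gap F (B.act (B.hist ω i) (ω i).1)
    ∂(Measure.infinitePi fun _ : ℕ => roundLaw F)

/-- `R_B(n) ≤ K √(A n log n)`: on every stationary instance with `σ²`-sub-Gaussian rewards and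
suboptimality gaps at most `C`, the regret over `n ≥ 2` rounds is at most `K √(A n log n)`. -/
def BanditAlg.HasMinimaxRate {A : ℕ} (B : BanditAlg A) (σ : ℝ≥0) (C K : ℝ) : Prop :=
  ∀ F : Fin A → ProbabilityMeasure ℝ, (∀ a, SubGaussian σ (F a)) → (∀ a, gap F a ≤ C) →
    ∀ n : ℕ, 2 ≤ n → B.regret F n ≤ K * √((A : ℝ) * n * Real.log n)

/-! ### Change detectors -/

/-- A causal detection rule: it decides from the samples received so far (oldest first) whether to
declare a change. -/
structure DetectionRule where
  alarm : List ℝ → Prop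
  measurableSet_alarm : ∀ n : ℕ, MeasurableSet {x : Fin n → ℝ | alarm (List.ofFn x)}

/-- The stopping time of the rule on the sample sequence `x 0, x 1, …`; the value `n ≥ 1` means that
the alarm is raised when the `n`-th sample, `x (n - 1)`, arrives. -/
def DetectionRule.alarmTime (D : DetectionRule) (x : ℕ → ℝ) : ℕ∞ :=
  sInf {s : ℕ∞ | ∃ n : ℕ, s = n ∧ 1 ≤ n ∧ D.alarm (List.ofFn fun i : Fin n => x i)}

/-- Law of the sample sequence without a change: independent samples from `f₀`. -/
def lawNoChange (f₀ : ProbabilityMeasure ℝ) : Measure (ℕ → ℝ) :=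
  Measure.infinitePi fun _ : ℕ => (f₀ : Measure ℝ)

/-- Law of the sample sequence with change-point `ν`: independent samples, the `n`-th from `f₀` for
`n < ν` and from `f₁` for `n ≥ ν`. -/
def lawChange (f₀ f₁ : ProbabilityMeasure ℝ) (ν : ℕ) : Measure (ℕ → ℝ) :=
  Measure.infinitePi fun i : ℕ =>
    ((if i + 1 < ν then f₀ else f₁ : ProbabilityMeasure ℝ) : Measure ℝ)

/-- The latency over horizon `M` for mean shift `Δ`, with pre-change window `m` and level `δD`: the
least `t ∈ {1,…,M}` such that `P_ν(τ ≥ ν + t) ≤ δD` for all `ν ∈ {m+1,…,M-t}` and all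
`σ²`-sub-Gaussian pre- and post-change distributions whose means differ by `Δ`. -/
def DetectionRule.latency (D : DetectionRule) (σ : ℝ≥0) (Δ : ℝ) (M m : ℕ) (δD : ℝ) : ℕ :=
  sInf {t : ℕ | 1 ≤ t ∧ t ≤ M ∧
    ∀ f₀ f₁ : ProbabilityMeasure ℝ, SubGaussian σ f₀ → SubGaussian σ f₁ →
      |mean f₀ - mean f₁| = Δ →
      ∀ ν : ℕ, m + 1 ≤ ν → ν ≤ M - t →
        (lawChange f₀ f₁ ν).real {x | ((ν + t : ℕ) : ℕ∞) ≤ D.alarmTime x} ≤ δD}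

/-- A change detector: for a horizon `M` and performance levels `δF`, `δD` a detection rule. -/
abbrev ChangeDetector : Type := ℕ → ℝ → ℝ → DetectionRule

/-- The requirements on a change detector with pre-change window `m Δ M δF δD` and latency (bound)
`d Δ M δF δD`. The case of equality in `latency_le` is the one in which `d` is the latency itself.
`K Δ` is the constant in the logarithmic bound. -/
structure ChangeDetector.Good (D : ChangeDetector) (σ : ℝ≥0) (m d : ℝ → ℕ → ℝ → ℝ → ℕ)
    (K : ℝ → ℝ) : Prop where
  false_alarm : ∀ (M : ℕ) (δF δD : ℝ), 2 ≤ M → δF ∈ Set.Ioo (0 : ℝ) 1 → δD ∈ Set.Ioo (0 : ℝ) 1 →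
    ∀ f₀ : ProbabilityMeasure ℝ, SubGaussian σ f₀ →
      (lawNoChange f₀).real {x | (D M δF δD).alarmTime x ≤ (M : ℕ∞)} ≤ δF
  latency_le : ∀ (Δ : ℝ) (M : ℕ) (δF δD : ℝ), 0 < Δ → 2 ≤ M → δF ∈ Set.Ioo (0 : ℝ) 1 →
    δD ∈ Set.Ioo (0 : ℝ) 1 →
      (D M δF δD).latency σ Δ M (m Δ M δF δD) δD ≤ d Δ M δF δD
  anti_shift : ∀ (Δ Δ' : ℝ) (M : ℕ) (δF δD : ℝ), 0 < Δ → Δ ≤ Δ' → 2 ≤ M →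
    δF ∈ Set.Ioo (0 : ℝ) 1 → δD ∈ Set.Ioo (0 : ℝ) 1 →
      m Δ' M δF δD ≤ m Δ M δF δD ∧ d Δ' M δF δD ≤ d Δ M δF δD
  mono_horizon : ∀ (Δ : ℝ) (M M' : ℕ) (δF δD : ℝ), 0 < Δ → 2 ≤ M → M ≤ M' →
    δF ∈ Set.Ioo (0 : ℝ) 1 → δD ∈ Set.Ioo (0 : ℝ) 1 →
      m Δ M δF δD ≤ m Δ M' δF δD ∧ d Δ M δF δD ≤ d Δ M' δF δD
  log_bound : ∀ (Δ : ℝ) (M : ℕ) (δF δD : ℝ), 0 < Δ → 2 ≤ M → δF ∈ Set.Ioo (0 : ℝ) 1 →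
    δD ∈ Set.Ioo (0 : ℝ) 1 →
      ((m Δ M δF δD + d Δ M δF δD : ℕ) : ℝ)
        ≤ K Δ * (Real.log M + Real.log (1 / δF) + Real.log (1 / δD))

/-! ### Piecewise-stationary environments -/

/-- A piecewise-stationary bandit with `A` arms, horizon `T`, `σ²`-sub-Gaussian rewards, `N`
change-points `ν 1 < ⋯ < ν N`, suboptimality gaps at most `C` and change gaps at least `Δ`.
`F k a` is the reward distribution of arm `a` during the `k`-th interval `{ν (k-1),…,ν k - 1}`,
for `k = 1,…,N+1`. -/
structure PSBandit (A T : ℕ) (σ : ℝ≥0) (C Δ : ℝ) where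
  N : ℕ
  ν : ℕ → ℕ
  F : ℕ → Fin A → ProbabilityMeasure ℝ
  ν_zero : ν 0 = 1
  ν_last : ν (N + 1) = T + 1
  ν_lt : ∀ k ≤ N, ν k < ν (k + 1)
  subGaussian : ∀ k, 1 ≤ k → k ≤ N + 1 → ∀ a, SubGaussian σ (F k a)
  gap_le : ∀ k, 1 ≤ k → k ≤ N + 1 → ∀ a, gap (F k) a ≤ C
  le_changeGap : ∀ k, 1 ≤ k → k ≤ N → Δ ≤ ⨆ a : Fin A, |mean (F (k + 1) a) - mean (F k a)|

/-- The number `k` of the interval that contains the round `t`. -/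
def PSBandit.interval {A T : ℕ} {σ : ℝ≥0} {C Δ : ℝ} (E : PSBandit A T σ C Δ) (t : ℕ) : ℕ :=
  ((Finset.Icc 1 E.N).filter fun k => E.ν k ≤ t).card + 1

/-- Law of all rounds: independent over time, round `t` following the distributions of its
interval. Only the rounds `1,…,T` are used. -/
def PSBandit.law {A T : ℕ} {σ : ℝ≥0} {C Δ : ℝ} (E : PSBandit A T σ C Δ) :
    Measure (ℕ → Round A) :=
  Measure.infinitePi fun t : ℕ => roundLaw (E.F (E.interval t))

/-! ### The detection augmented bandit procedure -/

/-- Which samples enter the history lists of the change detector: those of the forced exploration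
only, or those of the forced exploration and of the bandit algorithm. -/
inductive DetectorFeed where
  | forcedOnly
  | allSamples

/-- State of the procedure: last restart `τ`, number `k` of the current interval, history list of the
change detector for each arm, history list of the bandit algorithm. -/
structure State (A : ℕ) where
  τ : ℕ
  k : ℕ
  detHist : Fin A → List ℝ
  banHist : List (Fin A × ℝ)

/-- Restart at time `τ` with interval number `k`: all history lists are empty. -/
def State.fresh (A τ k : ℕ) : State A := ⟨τ, k, fun _ => [], []⟩

/-- Position of round `t` in the exploration cycle of length `⌈A / α_k⌉`; the value `a < A` means that
arm `a` (arms are numbered from `0`) is explored by force. -/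
def State.slot {A : ℕ} (s : State A) (α : ℕ → ℝ) (t : ℕ) : ℕ :=
  (t - s.τ - 1) % ⌈(A : ℝ) / α s.k⌉₊

/-- The arm played in round `t` from the state `s`, with seed `u`. -/
def State.arm {A : ℕ} (s : State A) (B : BanditAlg A) (α : ℕ → ℝ) (t : ℕ) (u : unitInterval) :
    Fin A :=
  if h : s.slot α t < A then ⟨s.slot α t, h⟩ else B.act s.banHist u

open Classical in
/-- One round of the procedure. -/
def State.step {A : ℕ} (s : State A) (feed : DetectorFeed) (B : BanditAlg A) (D : DetectionRule)
    (α : ℕ → ℝ) (t : ℕ) (r : Round A) : State A :=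
  let a : Fin A := s.arm B α t r.1
  let x : ℝ := r.2 a
  let forced : Prop := s.slot α t < A
  let fed : Prop := forced ∨ feed = DetectorFeed.allSamples
  let newHist : List ℝ := s.detHist a ++ [x]
  if fed ∧ D.alarm newHist then State.fresh A t (s.k + 1)
  else
    { τ := s.τ
      k := s.k
      detHist := if fed then Function.update s.detHist a newHist else s.detHist
      banHist := if forced then s.banHist else s.banHist ++ [(a, x)] }

/-- State of the procedure after the rounds `1,…,t`. -/
def state {A : ℕ} (feed : DetectorFeed) (B : BanditAlg A) (D : DetectionRule) (α : ℕ → ℝ)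
    (ω : ℕ → Round A) : ℕ → State A
  | 0 => State.fresh A 0 1
  | t + 1 => (state feed B D α ω t).step feed B D α (t + 1) (ω (t + 1))

/-- The arm played by the procedure in round `t ≥ 1`. -/
def playedArm {A : ℕ} (feed : DetectorFeed) (B : BanditAlg A) (D : DetectionRule) (α : ℕ → ℝ)
    (ω : ℕ → Round A) (t : ℕ) : Fin A :=
  (state feed B D α ω (t - 1)).arm B α t (ω t).1

/-- The (dynamic) regret of the procedure in the environment `E`. -/
def regret {A T : ℕ} {σ : ℝ≥0} {C Δ : ℝ} (E : PSBandit A T σ C Δ) (feed : DetectorFeed)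
    (B : BanditAlg A) (D : DetectionRule) (α : ℕ → ℝ) : ℝ :=
  ∫ ω, ∑ k ∈ Finset.Icc 1 (E.N + 1), ∑ t ∈ Finset.Ico (E.ν (k - 1)) (E.ν k),
    gap (E.F k) (playedArm feed B D α ω t) ∂E.law

/-- Forced exploration frequencies `α_k = α₀ √(k A log T / T)`. -/
def explorationFreq (α₀ : ℝ) (A T : ℕ) (k : ℕ) : ℝ :=
  α₀ * √((k : ℝ) * A * Real.log T / T)

/-- The number of rounds `⌈A / α_k⌉ n` in which each arm is explored `n` times during the `k`-th
interval; by convention it is `0` for `k = 0`. With `n` the pre-change window or the latency of the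
detector it is the pre-change window `m_k` or the latency `d_k` of the procedure. -/
def window (A : ℕ) (α : ℕ → ℝ) (n : ℕ) (k : ℕ) : ℕ :=
  if k = 0 then 0 else ⌈(A : ℝ) / α k⌉₊ * n

/-- The separation condition `d_{k-1} + m_k ≤ ν_k - ν_{k-1}` for `k = 1,…,N`. -/
def PSBandit.Separated {A T : ℕ} {σ : ℝ≥0} {C Δ : ℝ} (E : PSBandit A T σ C Δ) (α : ℕ → ℝ)
    (m d : ℕ) : Prop :=
  ∀ k, 1 ≤ k → k ≤ E.N → window A α d (k - 1) + window A α m k ≤ E.ν k - E.ν (k - 1)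

end DAB

end

/-!
The run of the procedure between two restarts is compared with a run in which alarms are not acted
upon (`virt`). A run of this kind from a restart at time `s` depends only on the rounds after `s`, so
it is independent of the event that the restart takes place, and since at most one restart carries
the interval number `k`, a bound for each fixed `s` is a bound for the random restart time
(`sum_integral_restartAt_le`). No union bound over restart times is needed; this is what makes
`γ > 1` suffice when only forced samples are used.

On a stretch after a restart three facts are needed.

* Whether the next reward of an arm becomes a sample is decided before that reward is drawn.
  Therefore the conditional probability, given the history list of the arm, of an event about
  independent samples is a supermartingale along the run (`lintegral_detHist_step`). In a stationary
  stretch this bounds the probability of a false alarm by `A δ_F` (`prob_false_alarm_le`). Across a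
  change it bounds the probability that the change is missed *and* the arm has exactly `n₀` samples
  before it by `δ_D` (`prob_miss_le_of_length`). With forced samples only, `n₀` is deterministic;
  with all samples a union bound over `n₀ < T` costs a factor `T`, whence `γ ≥ 2`
  (`prob_miss_le`).
* The bandit algorithm sees only its own rounds, whose positions are deterministic, so over these
  rounds it has its stationary regret (`integral_sum_gap_free`).
* Forced exploration takes at most `A` rounds in each cycle (`card_forced_le`).

Call the `k`-th interval entered in time if the procedure restarts with interval number `k` within the
latency `d_{k-1}` after the change. The separation condition leaves room for the pre-change window, so
each interval is entered in time, except with probability of order `k (A δ_F + δ_D)` or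
`k (A δ_F + T δ_D)` (`PSBandit.prob_not_restartIn_le`). The cost of an interval is then at most that
of the delay, of the exceptional event, of forced exploration and of the bandit algorithm
(`PSBandit.integral_interval_le`). If the last interval is shorter than the delay, all of it is charged
to the delay.

Summing over the intervals, `∑ k^{-1/2} ≤ 2 √N` for the delays and the Cauchy-Schwarz inequality for
the bandit algorithm give the rate (`regret_le_of_explorationFreq_le_one`). This requires
`α_{N+1} ≤ 1`, so that every arm is explored in each cycle, and `A N ≤ T`, `N log T ≤ T`. If one of
these fails, then the claimed bound exceeds the horizon up to a constant.
-/

/-! ### Measurability for lists -/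

/-- The σ-algebra on lists in which a set is measurable iff, for each `n`, its members of length `n`
form a measurable set of `n`-tuples. -/
instance List.instMeasurableSpaceOfFn {α : Type*} [MeasurableSpace α] : MeasurableSpace (List α) :=
  ⨅ n : ℕ, MeasurableSpace.map (List.ofFn : (Fin n → α) → List α) inferInstance

namespace DAB

section Lists

variable {α β γ : Type*} [MeasurableSpace α] [MeasurableSpace β] [MeasurableSpace γ]

lemma measurableSet_list_iff {S : Set (List α)} :
    MeasurableSet S ↔ ∀ n : ℕ, MeasurableSet {x : Fin n → α | List.ofFn x ∈ S} := by
  unfold List.instMeasurableSpaceOfFn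
  rw [MeasurableSpace.measurableSet_iInf]
  rfl

lemma measurable_list_iff {f : List α → β} :
    Measurable f ↔ ∀ n : ℕ, Measurable fun x : Fin n → α => f (List.ofFn x) := by
  constructor
  · intro h n S hS
    exact measurableSet_list_iff.1 (h hS) n
  · intro h S hS
    exact measurableSet_list_iff.2 fun n => h n hS

lemma measurable_ofFn (n : ℕ) : Measurable (List.ofFn : (Fin n → α) → List α) :=
  measurable_list_iff.1 measurable_id n

lemma measurable_length : Measurable (List.length : List α → ℕ) := by
  rw [measurable_list_iff]
  intro n
  simp

lemma measurable_getD (i : ℕ) (a : α) : Measurable fun l : List α => l.getD i a := by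
  rw [measurable_list_iff]
  intro n
  by_cases h : i < n
  · simp only [List.getD_eq_getElem?_getD, List.getElem?_ofFn, h, dif_pos, Option.getD_some]
    exact measurable_pi_apply _
  · simp only [List.getD_eq_getElem?_getD, List.getElem?_ofFn, h, dif_neg, not_false_eq_true,
      Option.getD_none]
    exact measurable_const

/-- Joint measurability in a list and a further variable can be checked at each length. -/
lemma measurable_list_prod [Nonempty α] {f : List α × β → γ}
    (h : ∀ n : ℕ, Measurable fun p : (Fin n → α) × β => f (List.ofFn p.1, p.2)) :
    Measurable f := by
  classical
  intro S hS
  let a : α := Classical.arbitrary α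
  have key : f ⁻¹' S = ⋃ n : ℕ, {p : List α × β | p.1.length = n} ∩
      (fun p : List α × β => ((fun i : Fin n => p.1.getD i a), p.2)) ⁻¹'
        ((fun p : (Fin n → α) × β => f (List.ofFn p.1, p.2)) ⁻¹' S) := by
    ext ⟨l, b⟩
    have hl : List.ofFn (fun i : Fin l.length => l.getD i a) = l := by
      apply List.ext_getElem <;> simp
    simp only [Set.mem_preimage, Set.mem_iUnion, Set.mem_inter_iff, Set.mem_ofPred_eq]
    constructor
    · intro hx
      refine ⟨l.length, rfl, ?_⟩
      rwa [hl]
    · rintro ⟨n, rfl, hx⟩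
      rwa [hl] at hx
  rw [key]
  refine MeasurableSet.iUnion fun n => MeasurableSet.inter ?_ ?_
  · exact (measurable_length.comp measurable_fst) (measurableSet_singleton n)
  · refine Measurable.prodMk ?_ measurable_snd (h n hS)
    exact measurable_pi_iff.2 fun i => (measurable_getD _ _).comp measurable_fst

lemma measurable_append_singleton [Nonempty α] :
    Measurable fun p : List α × α => p.1 ++ [p.2] := by
  refine measurable_list_prod fun n => ?_
  have : (fun p : (Fin n → α) × α => List.ofFn p.1 ++ [p.2])
      = fun p => List.ofFn (Fin.snoc (α := fun _ => α) p.1 p.2 : Fin (n + 1) → α) := by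
    funext p
    rw [List.ofFn_succ']
    simp
  show Measurable (fun p : (Fin n → α) × α => List.ofFn p.1 ++ [p.2])
  rw [this]
  refine (measurable_ofFn _).comp (measurable_pi_iff.2 fun i => ?_)
  refine Fin.lastCases ?_ (fun j => ?_) i
  · simpa using measurable_snd
  · simp only [Fin.snoc_castSucc]
    fun_prop

lemma measurable_apply_index {ι : Type*} [Countable ι] [MeasurableSpace ι]
    [MeasurableSingletonClass ι] {i : β → ι} (hi : Measurable i) {f : ι → β → γ}
    (hf : ∀ j, Measurable (f j)) : Measurable fun b => f (i b) b := by
  have : Measurable fun p : ι × β => f p.1 p.2 := measurable_from_prod_countable_right hf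
  exact this.comp (hi.prodMk measurable_id)

end Lists

/-! ### Resampling coordinates of a product measure -/

section Resampling

open scoped ENNReal

variable {X : Type*} [MeasurableSpace X]

open Classical in
lemma measurable_piecewise_prod (S : Set ℕ) :
    Measurable fun p : (ℕ → X) × (ℕ → X) => S.piecewise p.1 p.2 := by
  refine measurable_pi_iff.2 fun i => ?_
  by_cases h : i ∈ S
  · simp only [Set.piecewise, h, if_true]
    fun_prop
  · simp only [Set.piecewise, h, if_false]
    fun_prop

open Classical in
instance isProbabilityMeasure_piecewise (μ μ' : ℕ → Measure X) [∀ i, IsProbabilityMeasure (μ i)]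
    [∀ i, IsProbabilityMeasure (μ' i)] (S : Set ℕ) (i : ℕ) :
    IsProbabilityMeasure (S.piecewise μ μ' i) := by
  by_cases h : i ∈ S
  · simp only [Set.piecewise, h, if_true]
    infer_instance
  · simp only [Set.piecewise, h, if_false]
    infer_instance

open Classical in
/-- Taking the coordinates in `S` from one product measure and the others from an independent
second one gives the product measure with the corresponding factors. -/
lemma infinitePi_prod_map_piecewise (μ μ' : ℕ → Measure X) [∀ i, IsProbabilityMeasure (μ i)]
    [∀ i, IsProbabilityMeasure (μ' i)] (S : Set ℕ) :
    ((Measure.infinitePi μ).prod (Measure.infinitePi μ')).map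
      (fun p => S.piecewise p.1 p.2) = Measure.infinitePi (S.piecewise μ μ') := by
  refine Measure.eq_infinitePi _ fun s t ht => ?_
  rw [Measure.map_apply (measurable_piecewise_prod S)
    (.pi s.countable_toSet fun i _ => ht i)]
  have : (fun p : (ℕ → X) × (ℕ → X) => S.piecewise p.1 p.2) ⁻¹' (Set.pi s t)
      = (Set.pi (s.filter (· ∈ S) : Finset ℕ) t) ×ˢ (Set.pi (s.filter (· ∉ S) : Finset ℕ) t) := by
    ext ⟨x, y⟩
    simp only [Set.mem_preimage, Set.mem_pi, Set.mem_prod, Finset.coe_filter, Set.mem_ofPred_eq,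
      Finset.mem_coe]
    constructor
    · intro h
      refine ⟨fun i hi => ?_, fun i hi => ?_⟩
      · simpa [Set.piecewise, hi.2] using h i hi.1
      · simpa [Set.piecewise, hi.2] using h i hi.1
    · intro h i hi
      by_cases hS : i ∈ S
      · simpa [Set.piecewise, hS] using h.1 i ⟨hi, hS⟩
      · simpa [Set.piecewise, hS] using h.2 i ⟨hi, hS⟩
  rw [this, Measure.prod_prod, Measure.infinitePi_pi _ (fun i _ => ht i),
    Measure.infinitePi_pi _ (fun i _ => ht i), ← Finset.prod_filter_mul_prod_filter_not s (· ∈ S)]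
  congr 1
  · refine Finset.prod_congr rfl fun i hi => ?_
    simp [Set.piecewise, (Finset.mem_filter.1 hi).2]
  · refine Finset.prod_congr rfl fun i hi => ?_
    simp [Set.piecewise, (Finset.mem_filter.1 hi).2]

open Classical in
lemma measurePreserving_piecewise (μ : ℕ → Measure X) [∀ i, IsProbabilityMeasure (μ i)]
    (S : Set ℕ) :
    MeasurePreserving (fun p : (ℕ → X) × (ℕ → X) => S.piecewise p.1 p.2)
      ((Measure.infinitePi μ).prod (Measure.infinitePi μ)) (Measure.infinitePi μ) := by
  refine ⟨measurable_piecewise_prod S, ?_⟩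
  rw [infinitePi_prod_map_piecewise]
  congr 1
  funext i
  by_cases h : i ∈ S <;> simp [Set.piecewise, h]

/-- Functions of disjoint sets of coordinates are uncorrelated. -/
lemma integral_infinitePi_mul (μ : ℕ → Measure X) [∀ i, IsProbabilityMeasure (μ i)]
    (S : Set ℕ) {f g : (ℕ → X) → ℝ} (hf : Measurable f) (hg : Measurable g)
    (hfS : DependsOn f S) (hgS : DependsOn g Sᶜ) :
    ∫ ω, f ω * g ω ∂Measure.infinitePi μ
      = (∫ ω, f ω ∂Measure.infinitePi μ) * ∫ ω, g ω ∂Measure.infinitePi μ := by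
  classical
  have h := measurePreserving_piecewise μ S
  have hm := integral_map (μ := (Measure.infinitePi μ).prod (Measure.infinitePi μ))
    h.measurable.aemeasurable (f := fun ω => f ω * g ω)
    (hf.mul hg).aestronglyMeasurable
  rw [h.map_eq] at hm
  rw [hm, ← integral_prod_mul]
  refine integral_congr_ae (ae_of_all _ fun p => ?_)
  have h1 : f (S.piecewise p.1 p.2) = f p.1 := hfS fun i hi => by simp [hi]
  have h2 : g (S.piecewise p.1 p.2) = g p.2 := hgS fun i hi => by
    simp [Set.notMem_of_mem_compl hi]
  simp only [h1, h2]

/-- The integral of a function of the coordinates in `S` involves only the factors in `S`. -/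
lemma integral_infinitePi_congr (μ μ' : ℕ → Measure X) [∀ i, IsProbabilityMeasure (μ i)]
    [∀ i, IsProbabilityMeasure (μ' i)] (S : Set ℕ) (hμ : ∀ i ∈ S, μ i = μ' i) {f : (ℕ → X) → ℝ}
    (hf : Measurable f) (hfS : DependsOn f S) :
    ∫ ω, f ω ∂Measure.infinitePi μ = ∫ ω, f ω ∂Measure.infinitePi μ' := by
  classical
  have e : S.piecewise μ μ' = μ' := by
    funext i
    by_cases h : i ∈ S
    · simp [h, hμ i h]
    · simp [h]
  have h := infinitePi_prod_map_piecewise μ μ' S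
  rw [e] at h
  rw [← h, integral_map (measurable_piecewise_prod S).aemeasurable hf.aestronglyMeasurable]
  have h1 : ∀ p : (ℕ → X) × (ℕ → X), f (S.piecewise p.1 p.2) = f p.1 :=
    fun p => hfS fun i hi => by simp [hi]
  simp only [h1]
  rw [integral_fun_fst]
  simp

/-- A coordinate is independent of the others, so it may be integrated out first. -/
lemma lintegral_infinitePi_resample (μ : ℕ → Measure X) [∀ i, IsProbabilityMeasure (μ i)]
    (j : ℕ) {Ψ : (ℕ → X) → X → ℝ≥0∞} (hΨ : Measurable fun p : (ℕ → X) × X => Ψ p.1 p.2)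
    (hdep : ∀ x, DependsOn (fun ω => Ψ ω x) {j}ᶜ) :
    ∫⁻ ω, Ψ ω (ω j) ∂Measure.infinitePi μ
      = ∫⁻ ω, ∫⁻ x, Ψ ω x ∂μ j ∂Measure.infinitePi μ := by
  classical
  obtain ⟨S, hS⟩ : ∃ S : Set ℕ, S = {j}ᶜ := ⟨_, rfl⟩
  have hj : j ∉ S := by simp [hS]
  have h := measurePreserving_piecewise μ S
  have hm : Measurable fun ω : ℕ → X => Ψ ω (ω j) :=
    hΨ.comp (measurable_id.prodMk (measurable_pi_apply j))
  rw [← h.lintegral_comp hm]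
  have h1 : ∀ p : (ℕ → X) × (ℕ → X),
      Ψ (S.piecewise p.1 p.2) ((S.piecewise p.1 p.2) j) = Ψ p.1 (p.2 j) := fun p => by
    have e : (S.piecewise p.1 p.2) j = p.2 j := by simp [hj]
    rw [e]
    exact hdep (p.2 j) fun i hi => by simp [show i ∈ S from hS ▸ hi]
  refine (lintegral_congr h1).trans ?_
  rw [lintegral_prod]
  · refine lintegral_congr fun ω => ?_
    exact (measurePreserving_eval_infinitePi μ j).lintegral_comp
      (f := fun x => Ψ ω x) (hΨ.comp (measurable_const.prodMk measurable_id))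
  · exact (hΨ.comp (measurable_fst.prodMk
      ((measurable_pi_apply j).comp measurable_snd))).aemeasurable

/-- The law of finitely many distinct coordinates, each distributed as the corresponding coordinate
of another product measure. -/
lemma integral_infinitePi_reindex (μ μ' : ℕ → Measure X) [∀ i, IsProbabilityMeasure (μ i)]
    [∀ i, IsProbabilityMeasure (μ' i)] {e : ℕ → ℕ} (he : e.Injective) (S : Set ℕ)
    (hμ : ∀ i ∈ S, μ (e i) = μ' i) {f : (ℕ → X) → ℝ} (hf : Measurable f) (hfS : DependsOn f S) :
    ∫ ω, f (fun i => ω (e i)) ∂Measure.infinitePi μ = ∫ ω, f ω ∂Measure.infinitePi μ' := by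
  rw [← integral_infinitePi_congr (fun i => μ (e i)) μ' S hμ hf hfS,
    ← Measure.map_infinitePi_infinitePi_of_inj he, integral_map
      (measurable_pi_iff.2 fun i => measurable_pi_apply (e i)).aemeasurable
      hf.aestronglyMeasurable]

end Resampling

/-! ### Measurability of the procedure -/

/-- The σ-algebra on states generated by their four components. -/
instance State.instMeasurableSpace (A : ℕ) : MeasurableSpace (State A) :=
  MeasurableSpace.comap
    (fun s : State A => (s.τ, s.k, s.detHist, s.banHist)) inferInstance

namespace State

variable {A : ℕ}

lemma measurable_tuple :
    Measurable fun s : State A => (s.τ, s.k, s.detHist, s.banHist) :=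
  comap_measurable _

lemma measurable_τ : Measurable (State.τ : State A → ℕ) :=
  measurable_fst.comp measurable_tuple

lemma measurable_k : Measurable (State.k : State A → ℕ) :=
  (measurable_fst.comp measurable_snd).comp measurable_tuple

lemma measurable_detHist (a : Fin A) : Measurable fun s : State A => s.detHist a :=
  (measurable_pi_apply a).comp
    ((measurable_fst.comp (measurable_snd.comp measurable_snd)).comp measurable_tuple)

lemma measurable_banHist : Measurable (State.banHist : State A → List (Fin A × ℝ)) :=
  (measurable_snd.comp (measurable_snd.comp measurable_snd)).comp measurable_tuple

lemma measurable_mk {Ω : Type*} [MeasurableSpace Ω] {τ k : Ω → ℕ} {h : Ω → Fin A → List ℝ}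
    {b : Ω → List (Fin A × ℝ)} (hτ : Measurable τ) (hk : Measurable k)
    (hh : ∀ a, Measurable fun ω => h ω a) (hb : Measurable b) :
    Measurable fun ω => State.mk (τ ω) (k ω) (h ω) (b ω) := by
  refine measurable_comap_iff.2 ?_
  exact hτ.prodMk (hk.prodMk ((measurable_pi_iff.2 hh).prodMk hb))

lemma measurable_slot (α : ℕ → ℝ) (t : ℕ) : Measurable fun s : State A => s.slot α t := by
  have : Measurable fun p : ℕ × ℕ => (t - p.1 - 1) % ⌈(A : ℝ) / α p.2⌉₊ :=
    measurable_of_countable _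
  exact this.comp (measurable_τ.prodMk measurable_k)

lemma measurable_act (B : BanditAlg A) :
    Measurable fun p : List (Fin A × ℝ) × unitInterval => B.act p.1 p.2 := by
  have : Nonempty (Fin A) := ⟨B.act [] 0⟩
  exact measurable_list_prod B.measurable_act

lemma measurable_arm (B : BanditAlg A) (α : ℕ → ℝ) (t : ℕ) :
    Measurable fun p : State A × unitInterval => p.1.arm B α t p.2 := by
  let a₀ : Fin A := B.act [] 0
  have e : (fun p : State A × unitInterval => p.1.arm B α t p.2) = fun p =>
      if p.1.slot α t < A then (fun n => if h : n < A then ⟨n, h⟩ else a₀) (p.1.slot α t)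
        else B.act p.1.banHist p.2 := by
    funext p
    by_cases h : p.1.slot α t < A <;> simp [State.arm, h]
  rw [e]
  have hs : Measurable fun p : State A × unitInterval => p.1.slot α t :=
    (measurable_slot α t).comp measurable_fst
  refine Measurable.ite (hs measurableSet_Iio) ?_ ?_
  · exact (measurable_of_countable
      (fun n : ℕ => if h : n < A then (⟨n, h⟩ : Fin A) else a₀)).comp hs
  · exact (measurable_act B).comp ((measurable_banHist.comp measurable_fst).prodMk measurable_snd)

/-- The reward of the arm played in a round from the state `s` is fed to the detector. -/
def fed (s : State A) (feed : DetectorFeed) (α : ℕ → ℝ) (t : ℕ) : Prop :=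
  s.slot α t < A ∨ feed = DetectorFeed.allSamples

/-- The history list of the played arm, extended by the reward received in round `t`. -/
noncomputable def newHist (s : State A) (B : BanditAlg A) (α : ℕ → ℝ) (t : ℕ) (r : Round A) : List ℝ :=
  s.detHist (s.arm B α t r.1) ++ [r.2 (s.arm B α t r.1)]

/-- The detector declares a change in round `t`, played from the state `s`. -/
def alarms (s : State A) (feed : DetectorFeed) (B : BanditAlg A) (D : DetectionRule)
    (α : ℕ → ℝ) (t : ℕ) (r : Round A) : Prop :=
  s.fed feed α t ∧ D.alarm (s.newHist B α t r)

open Classical in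
/-- The successor of the state `s` in a round without alarm. -/
noncomputable def extend (s : State A) (feed : DetectorFeed) (B : BanditAlg A) (α : ℕ → ℝ) (t : ℕ)
    (r : Round A) : State A where
  τ := s.τ
  k := s.k
  detHist := fun b => if s.fed feed α t ∧ s.arm B α t r.1 = b then s.detHist b ++ [r.2 b]
    else s.detHist b
  banHist := if s.slot α t < A then s.banHist
    else s.banHist ++ [(s.arm B α t r.1, r.2 (s.arm B α t r.1))]

variable (s : State A) (feed : DetectorFeed) (B : BanditAlg A) (D : DetectionRule) (α : ℕ → ℝ)
  (t : ℕ) (r : Round A)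

lemma step_of_alarms (h : s.alarms feed B D α t r) :
    s.step feed B D α t r = State.fresh A t (s.k + 1) := by
  unfold alarms fed newHist at h
  simp only [step]
  rw [if_pos h]

lemma step_of_not_alarms (h : ¬ s.alarms feed B D α t r) :
    s.step feed B D α t r = s.extend feed B α t r := by
  unfold alarms newHist at h
  simp only [step, extend]
  change ¬ ((s.slot α t < A ∨ feed = DetectorFeed.allSamples) ∧ _) at h
  rw [if_neg h]
  congr 1
  funext b
  by_cases hf : s.fed feed α t
  · have hf' : s.slot α t < A ∨ feed = DetectorFeed.allSamples := hf
    rw [if_pos hf']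
    by_cases hb : s.arm B α t r.1 = b
    · subst hb
      simp [hf]
    · rw [Function.update_of_ne (Ne.symm hb)]
      simp [hb]
  · have hf' : ¬ (s.slot α t < A ∨ feed = DetectorFeed.allSamples) := hf
    rw [if_neg hf']
    simp [hf]

lemma measurableSet_fed : MeasurableSet {s : State A | s.fed feed α t} := by
  have : MeasurableSet {n : ℕ | n < A ∨ feed = DetectorFeed.allSamples} := .of_discrete
  exact measurable_slot α t this

lemma measurable_newHist :
    Measurable fun p : State A × Round A => p.1.newHist B α t p.2 := by
  have ha : Measurable fun p : State A × Round A => p.1.arm B α t p.2.1 :=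
    (measurable_arm B α t).comp (measurable_fst.prodMk (measurable_fst.comp measurable_snd))
  refine measurable_apply_index ha (f := fun b p => p.1.detHist b ++ [p.2.2 b]) fun b => ?_
  refine measurable_append_singleton.comp (Measurable.prodMk ?_ ?_)
  · exact (measurable_detHist b).comp measurable_fst
  · exact (measurable_pi_apply b).comp (measurable_snd.comp measurable_snd)

lemma measurableSet_alarms :
    MeasurableSet {p : State A × Round A | p.1.alarms feed B D α t p.2} := by
  have h : MeasurableSet {l : List ℝ | D.alarm l} :=
    measurableSet_list_iff.2 D.measurableSet_alarm
  exact (measurable_fst (measurableSet_fed feed α t)).inter (measurable_newHist B α t h)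

lemma measurable_extend :
    Measurable fun p : State A × Round A => p.1.extend feed B α t p.2 := by
  have : Nonempty (Fin A) := ⟨B.act [] 0⟩
  have ha : Measurable fun p : State A × Round A => p.1.arm B α t p.2.1 :=
    (measurable_arm B α t).comp (measurable_fst.prodMk (measurable_fst.comp measurable_snd))
  have hx : ∀ b : Fin A, Measurable fun p : State A × Round A => p.2.2 b := fun b =>
    (measurable_pi_apply b).comp (measurable_snd.comp measurable_snd)
  refine measurable_mk (measurable_τ.comp measurable_fst) (measurable_k.comp measurable_fst)
    (fun b => ?_) ?_
  · refine Measurable.ite ?_ ?_ ((measurable_detHist b).comp measurable_fst)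
    · exact (measurable_fst (measurableSet_fed feed α t)).inter (ha (measurableSet_singleton b))
    · exact measurable_append_singleton.comp
        (((measurable_detHist b).comp measurable_fst).prodMk (hx b))
  · refine Measurable.ite (((measurable_slot α t).comp measurable_fst) measurableSet_Iio)
      (measurable_banHist.comp measurable_fst) ?_
    refine measurable_append_singleton.comp
      ((measurable_banHist.comp measurable_fst).prodMk (ha.prodMk ?_))
    exact measurable_apply_index ha hx

open Classical in
lemma measurable_step :
    Measurable fun p : State A × Round A => p.1.step feed B D α t p.2 := by
  have e : (fun p : State A × Round A => p.1.step feed B D α t p.2) = fun p =>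
      if p.1.alarms feed B D α t p.2 then State.fresh A t (p.1.k + 1)
        else p.1.extend feed B α t p.2 := by
    funext p
    split_ifs with h
    · exact step_of_alarms _ _ _ _ _ _ _ h
    · exact step_of_not_alarms _ _ _ _ _ _ _ h
  rw [e]
  refine Measurable.ite (measurableSet_alarms feed B D α t) ?_ (measurable_extend feed B α t)
  exact measurable_mk measurable_const
    ((measurable_of_countable fun k : ℕ => k + 1).comp (measurable_k.comp measurable_fst))
    (fun _ => measurable_const) measurable_const

end State

variable {A : ℕ} (feed : DetectorFeed) (B : BanditAlg A) (D : DetectionRule) (α : ℕ → ℝ)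

lemma measurable_state (t : ℕ) : Measurable fun ω => state feed B D α ω t := by
  induction t with
  | zero => exact measurable_const
  | succ t ih =>
    exact (State.measurable_step feed B D α (t + 1)).comp (ih.prodMk (measurable_pi_apply _))

lemma dependsOn_state (t : ℕ) : DependsOn (fun ω => state feed B D α ω t) (Set.Iic t) := by
  induction t with
  | zero => intro _ _ _; rfl
  | succ t ih =>
    intro ω ω' h
    have h1 : state feed B D α ω t = state feed B D α ω' t :=
      ih fun i hi => h i (Set.mem_Iic.2 (le_trans (Set.mem_Iic.1 hi) t.le_succ))
    have h2 : ω (t + 1) = ω' (t + 1) := h _ (Set.mem_Iic.2 le_rfl)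
    simp only [state, h1, h2]

lemma measurable_playedArm (t : ℕ) : Measurable fun ω => playedArm feed B D α ω t :=
  (State.measurable_arm B α t).comp
    ((measurable_state feed B D α (t - 1)).prodMk (measurable_fst.comp (measurable_pi_apply t)))

/-! ### The procedure after a restart, without further alarms -/

/-- The state `n` rounds after a restart at time `s` with interval number `k`, if no alarm of the
detector is acted upon. -/
noncomputable def virt (s k : ℕ) (ω : ℕ → Round A) : ℕ → State A
  | 0 => State.fresh A s k
  | n + 1 => (virt s k ω n).extend feed B α (s + n + 1) (ω (s + n + 1))

/-- The detector would declare a change in the `n + 1`-st round after the restart at time `s`. -/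
def virtAlarm (s k : ℕ) (ω : ℕ → Round A) (n : ℕ) : Prop :=
  (virt feed B α s k ω n).alarms feed B D α (s + n + 1) (ω (s + n + 1))

/-- The arm played in the `n + 1`-st round after the restart at time `s`. -/
noncomputable def virtArm (s k : ℕ) (ω : ℕ → Round A) (n : ℕ) : Fin A :=
  (virt feed B α s k ω n).arm B α (s + n + 1) (ω (s + n + 1)).1

variable (s k : ℕ)

lemma measurable_virt (n : ℕ) : Measurable fun ω => virt feed B α s k ω n := by
  induction n with
  | zero => exact measurable_const
  | succ n ih =>
    exact (State.measurable_extend feed B α (s + n + 1)).comp (ih.prodMk (measurable_pi_apply _))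

lemma dependsOn_virt (n : ℕ) :
    DependsOn (fun ω => virt feed B α s k ω n) (Set.Ioc s (s + n)) := by
  induction n with
  | zero => intro _ _ _; rfl
  | succ n ih =>
    intro ω ω' h
    have h1 : virt feed B α s k ω n = virt feed B α s k ω' n :=
      ih fun i hi => h i ⟨hi.1, hi.2.trans (by omega)⟩
    have h2 : ω (s + n + 1) = ω' (s + n + 1) := h _ ⟨by omega, by omega⟩
    simp only [virt, h1, h2]

lemma measurable_virtArm (n : ℕ) : Measurable fun ω => virtArm feed B α s k ω n :=
  (State.measurable_arm B α (s + n + 1)).comp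
    ((measurable_virt feed B α s k n).prodMk (measurable_fst.comp (measurable_pi_apply _)))

lemma dependsOn_virtArm (n : ℕ) :
    DependsOn (fun ω => virtArm feed B α s k ω n) (Set.Ioc s (s + n + 1)) := by
  intro ω ω' h
  have h1 := dependsOn_virt feed B α s k n (x := ω) (y := ω') fun i hi => h i ⟨hi.1, by
    have := hi.2; omega⟩
  have h2 : ω (s + n + 1) = ω' (s + n + 1) := h _ ⟨by omega, by omega⟩
  simp only at h1
  simp only [virtArm, h1, h2]

lemma measurableSet_virtAlarm (n : ℕ) : MeasurableSet {ω | virtAlarm feed B D α s k ω n} :=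
  ((measurable_virt feed B α s k n).prodMk (measurable_pi_apply (s + n + 1)))
    (State.measurableSet_alarms feed B D α (s + n + 1))

lemma dependsOn_virtAlarm (n : ℕ) :
    DependsOn (fun ω => virtAlarm feed B D α s k ω n) (Set.Ioc s (s + n + 1)) := by
  intro ω ω' h
  have h1 := dependsOn_virt feed B α s k n (x := ω) (y := ω') fun i hi => h i ⟨hi.1, by
    have := hi.2; omega⟩
  have h2 : ω (s + n + 1) = ω' (s + n + 1) := h _ ⟨by omega, by omega⟩
  simp only at h1
  simp only [virtAlarm, h1, h2]

@[simp] lemma virt_τ (ω : ℕ → Round A) (n : ℕ) : (virt feed B α s k ω n).τ = s := by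
  induction n with
  | zero => rfl
  | succ n ih => simpa [virt, State.extend] using ih

@[simp] lemma virt_k (ω : ℕ → Round A) (n : ℕ) : (virt feed B α s k ω n).k = k := by
  induction n with
  | zero => rfl
  | succ n ih => simpa [virt, State.extend] using ih

@[simp] lemma virt_slot (ω : ℕ → Round A) (n : ℕ) :
    (virt feed B α s k ω n).slot α (s + n + 1) = n % ⌈(A : ℝ) / α k⌉₊ := by
  simp only [State.slot, virt_τ, virt_k]
  congr 1
  omega

variable {s k} {D} {ω : ℕ → Round A}

/-- Until its next alarm, the procedure follows the run without alarms. -/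
lemma state_eq_virt (h : state feed B D α ω s = State.fresh A s k) {n : ℕ}
    (hn : ∀ j < n, ¬ virtAlarm feed B D α s k ω j) :
    state feed B D α ω (s + n) = virt feed B α s k ω n := by
  induction n with
  | zero => exact h
  | succ n ih =>
    have h1 := ih fun j hj => hn j (by omega)
    have h2 := hn n (by omega)
    rw [← Nat.add_assoc]
    simp only [state, virt, h1]
    exact State.step_of_not_alarms _ _ _ _ _ _ _ h2

lemma playedArm_eq_virtArm (h : state feed B D α ω s = State.fresh A s k) {n : ℕ}
    (hn : ∀ j < n, ¬ virtAlarm feed B D α s k ω j) :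
    playedArm feed B D α ω (s + n + 1) = virtArm feed B α s k ω n := by
  simp only [playedArm, virtArm, Nat.add_sub_cancel, state_eq_virt feed B α h hn]

/-- The first alarm after a restart causes the next restart. -/
lemma state_of_first_alarm (h : state feed B D α ω s = State.fresh A s k) {n : ℕ}
    (hn : ∀ j < n, ¬ virtAlarm feed B D α s k ω j) (ha : virtAlarm feed B D α s k ω n) :
    state feed B D α ω (s + n + 1) = State.fresh A (s + n + 1) (k + 1) := by
  simp only [state, state_eq_virt feed B α h hn]
  rw [State.step_of_alarms _ _ _ _ _ _ _ ha, virt_k]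

lemma state_τ_le (t : ℕ) : (state feed B D α ω t).τ ≤ t := by
  induction t with
  | zero => exact le_rfl
  | succ t ih =>
    by_cases h : (state feed B D α ω t).alarms feed B D α (t + 1) (ω (t + 1))
    · simp only [state, State.step_of_alarms _ _ _ _ _ _ _ h]
      exact le_rfl
    · simp only [state, State.step_of_not_alarms _ _ _ _ _ _ _ h]
      exact le_trans ih t.le_succ

lemma state_k_mono : Monotone fun t => (state feed B D α ω t).k := by
  refine monotone_nat_of_le_succ fun t => ?_
  by_cases h : (state feed B D α ω t).alarms feed B D α (t + 1) (ω (t + 1))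
  · simp only [state, State.step_of_alarms _ _ _ _ _ _ _ h]
    exact Nat.le_succ _
  · simp only [state, State.step_of_not_alarms _ _ _ _ _ _ _ h]
    exact le_rfl

/-- At most one restart carries the interval number `k`. -/
lemma fresh_time_unique {s s' : ℕ} (h : state feed B D α ω s = State.fresh A s k)
    (h' : state feed B D α ω s' = State.fresh A s' k) : s = s' := by
  wlog hlt : s < s' generalizing s s'
  · rcases lt_trichotomy s s' with h1 | h1 | h1
    · exact this h h' h1
    · exact h1
    · exact (this h' h h1).symm
  obtain ⟨t, rfl⟩ : ∃ t, s' = t + 1 := ⟨s' - 1, by omega⟩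
  exfalso
  have hmono : (state feed B D α ω s).k ≤ (state feed B D α ω t).k :=
    state_k_mono feed B α (by omega)
  rw [h] at hmono
  by_cases ha : (state feed B D α ω t).alarms feed B D α (t + 1) (ω (t + 1))
  · simp only [state, State.step_of_alarms _ _ _ _ _ _ _ ha] at h'
    have := congrArg State.k h'
    simp only [State.fresh] at this hmono
    omega
  · simp only [state, State.step_of_not_alarms _ _ _ _ _ _ _ ha] at h'
    have := congrArg State.τ h'
    have hle := state_τ_le feed B α (D := D) (ω := ω) t
    simp only [State.fresh, State.extend] at this
    omega

/-! ### Conditional probabilities of alarms given the first samples -/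

section Splice

open scoped ENNReal

/-- The sequence `x` with its first terms replaced by the list `l`. -/
def splice (l : List ℝ) (x : ℕ → ℝ) : ℕ → ℝ := fun i => l.getD i (x i)

lemma measurable_splice : Measurable fun p : List ℝ × (ℕ → ℝ) => splice p.1 p.2 := by
  refine measurable_pi_iff.2 fun i => measurable_list_prod fun n => ?_
  by_cases h : i < n
  · simp only [splice, List.getD_eq_getElem?_getD, List.getElem?_ofFn, h, dif_pos, Option.getD_some]
    fun_prop
  · simp only [splice, List.getD_eq_getElem?_getD, List.getElem?_ofFn, h, dif_neg,
      not_false_eq_true, Option.getD_none]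
    fun_prop

@[simp] lemma splice_nil (x : ℕ → ℝ) : splice [] x = x := by
  funext i
  simp [splice]

lemma splice_append_singleton (l : List ℝ) (y : ℝ) (x : ℕ → ℝ) :
    splice (l ++ [y]) x = splice l (Function.update x l.length y) := by
  funext i
  unfold splice
  rcases lt_trichotomy i l.length with h | h | h
  · rw [List.getD_append _ _ _ _ h, List.getD_eq_getElem _ _ h, List.getD_eq_getElem _ _ h]
  · subst h
    simp
  · rw [List.getD_eq_default _ _ (by simp; omega), List.getD_eq_default _ _ h.le,
      Function.update_of_ne (by omega)]

lemma ofFn_splice {l l' : List ℝ} (h : l' <+: l) (x : ℕ → ℝ) :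
    List.ofFn (fun i : Fin l'.length => splice l x i) = l' := by
  obtain ⟨r, rfl⟩ := h
  apply List.ext_getElem
  · simp
  · intro i h1 h2
    simp only [List.getElem_ofFn, splice]
    rw [List.getD_append _ _ _ _ h2, List.getD_eq_getElem _ _ h2]

/-- Probability that a sequence of independent samples with laws `μ` belongs to `S`, given that it
starts with `l`. -/
noncomputable def condProb (μ : ℕ → Measure ℝ) (S : Set (ℕ → ℝ)) (l : List ℝ) : ℝ≥0∞ :=
  Measure.infinitePi μ {x | splice l x ∈ S}

variable (μ : ℕ → Measure ℝ) {S : Set (ℕ → ℝ)}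

lemma condProb_nil : condProb μ S [] = Measure.infinitePi μ S := by
  simp [condProb]

variable [∀ i, IsProbabilityMeasure (μ i)]

lemma measurable_condProb (hS : MeasurableSet S) : Measurable (condProb μ S) :=
  measurable_measure_prodMk_left (measurable_splice hS)

lemma condProb_of_forall {l : List ℝ} (h : ∀ x, splice l x ∈ S) : condProb μ S l = 1 := by
  simp [condProb, h]

/-- The conditional probabilities form a martingale. -/
lemma lintegral_condProb_append (hS : MeasurableSet S) (l : List ℝ) :
    ∫⁻ y, condProb μ S (l ++ [y]) ∂μ l.length = condProb μ S l := by
  let Ψ : (ℕ → ℝ) → ℝ → ℝ≥0∞ := fun x y => S.indicator 1 (splice (l ++ [y]) x)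
  have hm : Measurable fun p : (ℕ → ℝ) × ℝ => splice (l ++ [p.2]) p.1 := by
    refine measurable_splice.comp (Measurable.prodMk ?_ measurable_fst)
    exact measurable_append_singleton.comp (measurable_const.prodMk measurable_snd)
  have hΨ : Measurable fun p : (ℕ → ℝ) × ℝ => Ψ p.1 p.2 :=
    (measurable_one.indicator hS).comp hm
  have h1 := lintegral_infinitePi_resample μ l.length hΨ fun y x x' hx => by
    have : splice (l ++ [y]) x = splice (l ++ [y]) x' := by
      rw [splice_append_singleton, splice_append_singleton]
      congr 1
      funext i
      by_cases hi : i = l.length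
      · subst hi; simp
      · rw [Function.update_of_ne hi, Function.update_of_ne hi]
        exact hx i hi
    simp only [Ψ, this]
  have h2 : ∫⁻ x, Ψ x (x l.length) ∂Measure.infinitePi μ = condProb μ S l := by
    simp only [Ψ, splice_append_singleton, Function.update_eq_self]
    exact lintegral_indicator_one
      ((measurable_splice.comp (measurable_const.prodMk measurable_id)) hS)
  rw [← h2, h1, lintegral_lintegral_swap hΨ.aemeasurable]
  refine lintegral_congr fun y => ?_
  exact (lintegral_indicator_one
      ((measurable_splice.comp (measurable_const.prodMk measurable_id)) hS)).symm

end Splice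

/-! ### Alarm times of a detection rule -/

/-- The sample sequences on which the rule raises an alarm within the first `H` samples. -/
def DetectionRule.alarmBy (D : DetectionRule) (H : ℕ) : Set (ℕ → ℝ) :=
  {x | ∃ n, 1 ≤ n ∧ n ≤ H ∧ D.alarm (List.ofFn fun i : Fin n => x i)}

lemma DetectionRule.measurableSet_alarmBy (D : DetectionRule) (H : ℕ) :
    MeasurableSet (D.alarmBy H) := by
  have : D.alarmBy H = ⋃ n : ℕ, {x | 1 ≤ n ∧ n ≤ H ∧ D.alarm (List.ofFn fun i : Fin n => x i)} := by
    ext x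
    simp [alarmBy]
  rw [this]
  refine MeasurableSet.iUnion fun n => ?_
  have h : MeasurableSet {x : ℕ → ℝ | D.alarm (List.ofFn fun i : Fin n => x i)} := by
    have hm : Measurable fun (x : ℕ → ℝ) (i : Fin n) => x i := by fun_prop
    exact hm (D.measurableSet_alarm n)
  exact (MeasurableSet.const (1 ≤ n)).inter ((MeasurableSet.const (n ≤ H)).inter h)

lemma DetectionRule.succ_le_alarmTime_iff (D : DetectionRule) (H : ℕ) (x : ℕ → ℝ) :
    ((H + 1 : ℕ) : ℕ∞) ≤ D.alarmTime x ↔ x ∉ D.alarmBy H := by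
  unfold alarmTime alarmBy
  rw [le_sInf_iff]
  constructor
  · rintro h ⟨n, h1, h2, h3⟩
    have := h n ⟨n, rfl, h1, h3⟩
    norm_cast at this
    omega
  · rintro h _ ⟨n, rfl, h1, h3⟩
    norm_cast
    by_contra hn
    exact h ⟨n, h1, by omega, h3⟩

lemma DetectionRule.alarmTime_le_iff (D : DetectionRule) (H : ℕ) (x : ℕ → ℝ) :
    D.alarmTime x ≤ (H : ℕ∞) ↔ x ∈ D.alarmBy H := by
  rw [← not_iff_not, ← D.succ_le_alarmTime_iff, not_le, Nat.cast_add, Nat.cast_one,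
    ENat.add_one_le_iff (ENat.natCast_ne_top H)]

lemma DetectionRule.splice_mem_alarmBy (D : DetectionRule) {H : ℕ} {l l' : List ℝ} (h : l' <+: l)
    (hne : l' ≠ []) (hH : l'.length ≤ H) (ha : D.alarm l') (x : ℕ → ℝ) :
    splice l x ∈ D.alarmBy H := by
  refine ⟨l'.length, List.length_pos_iff.2 hne, hH, ?_⟩
  rwa [ofFn_splice h]

lemma DetectionRule.splice_notMem_alarmBy (D : DetectionRule) {H : ℕ} {l : List ℝ}
    (hH : H ≤ l.length) (ha : ∀ l', l' <+: l → l' ≠ [] → ¬ D.alarm l') (x : ℕ → ℝ) :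
    splice l x ∉ D.alarmBy H := by
  rintro ⟨n, h1, h2, h3⟩
  have hl : (l.take n).length = n := by simp; omega
  have := ofFn_splice (List.take_prefix n l) x
  refine ha (l.take n) (List.take_prefix n l) (by rw [← List.length_pos_iff]; omega) ?_
  have e : ∀ m, m = n → List.ofFn (fun i : Fin m => splice l x i)
      = List.ofFn (fun i : Fin n => splice l x i) := by rintro m rfl; rfl
  rwa [← this, e _ hl]

/-! ### Detector histories in the run without alarms -/

section Histories

variable {A : ℕ} (feed : DetectorFeed) (B : BanditAlg A) (D : DetectionRule) (α : ℕ → ℝ) (s k : ℕ)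
  (ω : ℕ → Round A)

lemma detHist_succ_of_fed {n : ℕ} {a : Fin A}
    (hf : (virt feed B α s k ω n).fed feed α (s + n + 1)) (ha : virtArm feed B α s k ω n = a) :
    (virt feed B α s k ω (n + 1)).detHist a
      = (virt feed B α s k ω n).detHist a ++ [(ω (s + n + 1)).2 a] := by
  unfold virtArm at ha
  simp only [virt, State.extend]
  rw [if_pos ⟨hf, ha⟩]

lemma detHist_succ_of_not {n : ℕ} {a : Fin A}
    (h : ¬ ((virt feed B α s k ω n).fed feed α (s + n + 1) ∧ virtArm feed B α s k ω n = a)) :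
    (virt feed B α s k ω (n + 1)).detHist a = (virt feed B α s k ω n).detHist a := by
  unfold virtArm at h
  simp only [virt, State.extend]
  rw [if_neg h]

lemma length_detHist_le (n : ℕ) (a : Fin A) : ((virt feed B α s k ω n).detHist a).length ≤ n := by
  induction n with
  | zero => exact le_rfl
  | succ n ih =>
    by_cases h : (virt feed B α s k ω n).fed feed α (s + n + 1) ∧ virtArm feed B α s k ω n = a
    · rw [detHist_succ_of_fed feed B α s k ω h.1 h.2]
      simpa using ih
    · rw [detHist_succ_of_not feed B α s k ω h]
      omega

lemma length_detHist_mono (a : Fin A) :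
    Monotone fun n => ((virt feed B α s k ω n).detHist a).length := by
  refine monotone_nat_of_le_succ fun n => ?_
  by_cases h : (virt feed B α s k ω n).fed feed α (s + n + 1) ∧ virtArm feed B α s k ω n = a
  · rw [detHist_succ_of_fed feed B α s k ω h.1 h.2]
    simp
  · rw [detHist_succ_of_not feed B α s k ω h]

/-- Within every exploration cycle each arm contributes a sample. -/
lemma length_detHist_add_cycle (n : ℕ) (a : Fin A) (hL : A ≤ ⌈(A : ℝ) / α k⌉₊) :
    ((virt feed B α s k ω n).detHist a).length + 1
      ≤ ((virt feed B α s k ω (n + ⌈(A : ℝ) / α k⌉₊)).detHist a).length := by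
  set L := ⌈(A : ℝ) / α k⌉₊ with hLdef
  have ha : (a : ℕ) < L := lt_of_lt_of_le a.2 hL
  obtain ⟨j, hj1, hj2, hj3⟩ : ∃ j, n ≤ j ∧ j < n + L ∧ j % L = a := by
    have h1 := Nat.mod_lt n (show 0 < L by omega)
    have h2 := Nat.div_add_mod n L
    rcases le_or_gt (n % L) a with h | h
    · refine ⟨n - n % L + a, by omega, by omega, ?_⟩
      have : n - n % L + a = L * (n / L) + a := by omega
      rw [this, Nat.mul_add_mod, Nat.mod_eq_of_lt ha]
    · refine ⟨n - n % L + L + a, by omega, by omega, ?_⟩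
      have : n - n % L + L + a = L * (n / L + 1) + a := by rw [Nat.mul_add]; omega
      rw [this, Nat.mul_add_mod, Nat.mod_eq_of_lt ha]
  have hslot : (virt feed B α s k ω j).slot α (s + j + 1) = a := by
    rw [virt_slot, ← hLdef, hj3]
  have hlt : (virt feed B α s k ω j).slot α (s + j + 1) < A := hslot ▸ a.2
  have hfed : (virt feed B α s k ω j).fed feed α (s + j + 1) := Or.inl hlt
  have harm : virtArm feed B α s k ω j = a := by
    unfold virtArm State.arm
    rw [dif_pos hlt]
    exact Fin.ext hslot
  have h1 := length_detHist_mono feed B α s k ω a hj1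
  have h2 := length_detHist_mono feed B α s k ω a (show j + 1 ≤ n + L by omega)
  simp only at h1 h2
  rw [detHist_succ_of_fed feed B α s k ω hfed harm, List.length_append] at h2
  simp only [List.length_singleton] at h2
  omega

lemma length_detHist_add_cycles (n c : ℕ) (a : Fin A) (hL : A ≤ ⌈(A : ℝ) / α k⌉₊) :
    ((virt feed B α s k ω n).detHist a).length + c
      ≤ ((virt feed B α s k ω (n + ⌈(A : ℝ) / α k⌉₊ * c)).detHist a).length := by
  induction c with
  | zero => simp
  | succ c ih =>
    have := length_detHist_add_cycle feed B α s k ω (n + ⌈(A : ℝ) / α k⌉₊ * c) a hL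
    rw [show n + ⌈(A : ℝ) / α k⌉₊ * (c + 1) = n + ⌈(A : ℝ) / α k⌉₊ * c + ⌈(A : ℝ) / α k⌉₊ by ring]
    omega

/-- With forced samples only, the number of samples of an arm is deterministic. -/
lemma length_detHist_forcedOnly (ω' : ℕ → Round A) (n : ℕ) (a : Fin A) :
    ((virt .forcedOnly B α s k ω n).detHist a).length
      = ((virt .forcedOnly B α s k ω' n).detHist a).length := by
  induction n with
  | zero => rfl
  | succ n ih =>
    simp only [virt, State.extend]
    have hfed : ∀ ω : ℕ → Round A, (virt .forcedOnly B α s k ω n).fed .forcedOnly α (s + n + 1)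
        ↔ n % ⌈(A : ℝ) / α k⌉₊ < A := fun ω => by simp [State.fed]
    have harm : ∀ ω : ℕ → Round A, ∀ h : n % ⌈(A : ℝ) / α k⌉₊ < A,
        (virt .forcedOnly B α s k ω n).arm B α (s + n + 1) (ω (s + n + 1)).1
          = ⟨n % ⌈(A : ℝ) / α k⌉₊, h⟩ := fun ω h => by
      have h' : (virt .forcedOnly B α s k ω n).slot α (s + n + 1) < A := by rwa [virt_slot]
      unfold State.arm
      rw [dif_pos h']
      exact Fin.ext (virt_slot _ _ _ _ _ _ _)
    by_cases h : n % ⌈(A : ℝ) / α k⌉₊ < A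
    · by_cases ha : (⟨n % ⌈(A : ℝ) / α k⌉₊, h⟩ : Fin A) = a
      · rw [if_pos ⟨(hfed ω).2 h, (harm ω h).trans ha⟩,
          if_pos ⟨(hfed ω').2 h, (harm ω' h).trans ha⟩]
        simpa using ih
      · rw [if_neg fun hc => ha ((harm ω h).symm.trans hc.2),
          if_neg fun hc => ha ((harm ω' h).symm.trans hc.2)]
        exact ih
    · rw [if_neg fun hc => h ((hfed ω).1 hc.1), if_neg fun hc => h ((hfed ω').1 hc.1)]
      exact ih

/-- An alarm has been declared by some round iff a history list has an initial segment on which the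
detection rule raises an alarm. -/
lemma exists_virtAlarm_iff (n : ℕ) :
    (∃ j < n, virtAlarm feed B D α s k ω j) ↔
      ∃ a, ∃ l', l' <+: (virt feed B α s k ω n).detHist a ∧ l' ≠ [] ∧ D.alarm l' := by
  induction n with
  | zero =>
    simp only [Nat.not_lt_zero, false_and, exists_false, false_iff]
    rintro ⟨a, l', h1, h2, -⟩
    exact h2 (List.prefix_nil.1 h1)
  | succ n ih =>
    have hsplit : (∃ j < n + 1, virtAlarm feed B D α s k ω j) ↔
        (∃ j < n, virtAlarm feed B D α s k ω j) ∨ virtAlarm feed B D α s k ω n := by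
      constructor
      · rintro ⟨j, hj, h⟩
        rcases Nat.lt_succ_iff_lt_or_eq.1 hj with h1 | rfl
        · exact Or.inl ⟨j, h1, h⟩
        · exact Or.inr h
      · rintro (⟨j, hj, h⟩ | h)
        · exact ⟨j, by omega, h⟩
        · exact ⟨n, by omega, h⟩
    rw [hsplit, ih]
    have hal : virtAlarm feed B D α s k ω n ↔ (virt feed B α s k ω n).fed feed α (s + n + 1) ∧
        D.alarm ((virt feed B α s k ω n).detHist (virtArm feed B α s k ω n)
          ++ [(ω (s + n + 1)).2 (virtArm feed B α s k ω n)]) := Iff.rfl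
    rw [hal]
    constructor
    · rintro (⟨a, l', h1, h2, h3⟩ | ⟨hf, h⟩)
      · refine ⟨a, l', h1.trans ?_, h2, h3⟩
        by_cases h : (virt feed B α s k ω n).fed feed α (s + n + 1)
            ∧ virtArm feed B α s k ω n = a
        · rw [detHist_succ_of_fed feed B α s k ω h.1 h.2]
          exact List.prefix_append _ _
        · rw [detHist_succ_of_not feed B α s k ω h]
      · refine ⟨virtArm feed B α s k ω n, _, ?_, ?_, h⟩
        · rw [detHist_succ_of_fed feed B α s k ω hf rfl]
        · simp
    · rintro ⟨a, l', h1, h2, h3⟩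
      by_cases h : (virt feed B α s k ω n).fed feed α (s + n + 1) ∧ virtArm feed B α s k ω n = a
      · rw [detHist_succ_of_fed feed B α s k ω h.1 h.2, List.prefix_concat_iff] at h1
        rcases h1 with rfl | h1
        · refine Or.inr ⟨h.1, ?_⟩
          rw [h.2]
          exact h3
        · exact Or.inl ⟨a, l', h1, h2, h3⟩
      · rw [detHist_succ_of_not feed B α s k ω h] at h1
        exact Or.inl ⟨a, l', h1, h2, h3⟩

end Histories

/-! ### False alarms and missed detections for adaptively drawn samples -/

section Detection

open scoped ENNReal

variable {A : ℕ} (feed : DetectorFeed) (B : BanditAlg A) (D : DetectionRule) (α : ℕ → ℝ) (s k : ℕ)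
  (F : ℕ → Fin A → ProbabilityMeasure ℝ)

/-- Optional skipping, in the form of a one-step supermartingale inequality: whether the next reward
of arm `a` becomes a sample is decided by the past and the seed, which are independent of it. The
weight `w` is an event of the past. -/
lemma lintegral_detHist_step (n : ℕ) (a : Fin A) {w : (ℕ → Round A) → ℝ≥0∞} (hw : Measurable w)
    (hwd : DependsOn w (Set.Iic (s + n))) {Q Q' : List ℝ → ℝ≥0∞} (hQ' : Measurable Q')
    (h0 : ∀ l, Q' l ≤ Q l) (h1 : ∀ l, ∫⁻ x, Q' (l ++ [x]) ∂(F (s + n + 1) a : Measure ℝ) ≤ Q l) :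
    ∫⁻ ω, w ω * Q' ((virt feed B α s k ω (n + 1)).detHist a)
        ∂Measure.infinitePi (fun t => roundLaw (F t))
      ≤ ∫⁻ ω, w ω * Q ((virt feed B α s k ω n).detHist a)
        ∂Measure.infinitePi (fun t => roundLaw (F t)) := by
  let Ψ : (ℕ → Round A) → Round A → ℝ≥0∞ := fun ω r =>
    w ω * Q' (((virt feed B α s k ω n).extend feed B α (s + n + 1) r).detHist a)
  have hm : Measurable fun p : (ℕ → Round A) × Round A =>
      Q' (((virt feed B α s k p.1 n).extend feed B α (s + n + 1) p.2).detHist a) :=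
    hQ'.comp ((State.measurable_detHist a).comp
      ((State.measurable_extend feed B α (s + n + 1)).comp
        (((measurable_virt feed B α s k n).comp measurable_fst).prodMk measurable_snd)))
  have hΨ : Measurable fun p : (ℕ → Round A) × Round A => Ψ p.1 p.2 :=
    (hw.comp measurable_fst).mul hm
  have key := lintegral_infinitePi_resample (fun t => roundLaw (F t)) (s + n + 1) hΨ
    fun r ω ω' h => by
      have e1 : w ω = w ω' := hwd fun i hi => h i (by
        have := Set.mem_Iic.1 hi
        simp only [Set.mem_compl_iff, Set.mem_singleton_iff]
        omega)
      have e2 : virt feed B α s k ω n = virt feed B α s k ω' n :=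
        dependsOn_virt feed B α s k n fun i hi => h i (by
          have := hi.2
          simp only [Set.mem_compl_iff, Set.mem_singleton_iff]
          omega)
      simp only [Ψ, e1, e2]
  refine (le_of_eq key).trans (lintegral_mono fun ω => ?_)
  simp only [Ψ]
  have hmω : Measurable fun r : Round A =>
      Q' (((virt feed B α s k ω n).extend feed B α (s + n + 1) r).detHist a) :=
    hm.comp (measurable_const.prodMk measurable_id)
  rw [lintegral_const_mul _ hmω]
  gcongr
  set st := virt feed B α s k ω n
  rw [roundLaw, lintegral_prod _ hmω.aemeasurable]
  -- It suffices to bound the mean over the rewards for each value of the seed.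
  suffices h : ∀ u : unitInterval, ∫⁻ y, Q' ((st.extend feed B α (s + n + 1) (u, y)).detHist a)
      ∂Measure.pi (fun a => (F (s + n + 1) a : Measure ℝ)) ≤ Q (st.detHist a) by
    refine (lintegral_mono h).trans ?_
    simp
  intro u
  by_cases hc : st.fed feed α (s + n + 1) ∧ st.arm B α (s + n + 1) u = a
  · have e : ∀ y : Fin A → ℝ, (st.extend feed B α (s + n + 1) (u, y)).detHist a
        = st.detHist a ++ [y a] := fun y => by
      simp only [State.extend]
      rw [if_pos hc]
    simp only [e]
    refine le_trans (le_of_eq ?_) (h1 _)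
    have hmeas : Measurable fun x : ℝ => Q' (st.detHist a ++ [x]) :=
      hQ'.comp (measurable_append_singleton.comp (measurable_const.prodMk measurable_id))
    exact (measurePreserving_eval (fun a => (F (s + n + 1) a : Measure ℝ)) a).lintegral_comp hmeas
  · have e : ∀ y : Fin A → ℝ, (st.extend feed B α (s + n + 1) (u, y)).detHist a
        = st.detHist a := fun y => by
      simp only [State.extend]
      rw [if_neg hc]
    simp only [e]
    simpa using h0 _

/-- In a stationary stretch, a false alarm on the samples of one arm is as unlikely as without
adaptive sampling. -/
lemma lintegral_condProb_detHist_le {H n : ℕ} (a : Fin A) (f : ProbabilityMeasure ℝ)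
    (hF : ∀ j < n, F (s + j + 1) a = f) :
    ∫⁻ ω, condProb (fun _ => (f : Measure ℝ)) (D.alarmBy H) ((virt feed B α s k ω n).detHist a)
        ∂Measure.infinitePi (fun t => roundLaw (F t))
      ≤ lawNoChange f (D.alarmBy H) := by
  induction n with
  | zero =>
    simp only [virt, State.fresh, condProb_nil]
    simp [lawNoChange]
  | succ n ih =>
    refine le_trans ?_ (ih fun j hj => hF j (by omega))
    have := lintegral_detHist_step feed B α s k F n a (w := fun _ => 1) measurable_const
      (fun _ _ _ => rfl)
      (Q := condProb (fun _ => (f : Measure ℝ)) (D.alarmBy H))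
      (measurable_condProb (fun _ => (f : Measure ℝ)) (D.measurableSet_alarmBy H))
      (fun _ => le_rfl) (fun l => by
        rw [hF n (by omega)]
        exact (lintegral_condProb_append (fun _ => (f : Measure ℝ))
          (D.measurableSet_alarmBy H) l).le)
    simpa only [one_mul] using this

lemma measurableSet_exists_virtAlarm (n : ℕ) :
    MeasurableSet {ω | ∃ j < n, virtAlarm feed B D α s k ω j} := by
  have : {ω | ∃ j < n, virtAlarm feed B D α s k ω j}
      = ⋃ j ∈ Finset.range n, {ω | virtAlarm feed B D α s k ω j} := by
    ext ω
    simp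
  rw [this]
  exact Finset.measurableSet_biUnion _ fun j _ => measurableSet_virtAlarm feed B D α s k j

/-- Union bound over the arms for false alarms in a stationary stretch. -/
lemma prob_false_alarm_le {H n : ℕ} (hn : n ≤ H) (f : Fin A → ProbabilityMeasure ℝ)
    (hF : ∀ j < n, F (s + j + 1) = f) {δ : ℝ}
    (hδ : ∀ a, (lawNoChange (f a)).real {x | D.alarmTime x ≤ (H : ℕ∞)} ≤ δ) :
    (Measure.infinitePi (fun t => roundLaw (F t))).real
      {ω | ∃ j < n, virtAlarm feed B D α s k ω j} ≤ A * δ := by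
  set P := Measure.infinitePi (fun t => roundLaw (F t))
  let q : Fin A → (ℕ → Round A) → ℝ≥0∞ := fun a ω =>
    condProb (fun _ => (f a : Measure ℝ)) (D.alarmBy H) ((virt feed B α s k ω n).detHist a)
  have hsub : {ω | ∃ j < n, virtAlarm feed B D α s k ω j} ⊆ ⋃ a, {ω | 1 ≤ q a ω} := by
    intro ω hω
    obtain ⟨a, l', h1, h2, h3⟩ := (exists_virtAlarm_iff feed B D α s k ω n).1 hω
    refine Set.mem_iUnion.2 ⟨a, ?_⟩
    have hlen : l'.length ≤ H :=
      h1.length_le.trans ((length_detHist_le feed B α s k ω n a).trans hn)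
    exact (condProb_of_forall _ (D.splice_mem_alarmBy h1 h2 hlen h3)).ge
  have hq : ∀ a, P.real {ω | 1 ≤ q a ω} ≤ δ := by
    intro a
    have hset : {x | D.alarmTime x ≤ (H : ℕ∞)} = D.alarmBy H := by
      ext x
      exact D.alarmTime_le_iff H x
    have hprob : IsProbabilityMeasure (lawNoChange (f a)) := by
      unfold lawNoChange; infer_instance
    have h1 := hδ a
    rw [hset] at h1
    refine le_trans ?_ h1
    refine ENNReal.toReal_mono (measure_ne_top _ _) ?_
    refine le_trans ?_ (lintegral_condProb_detHist_le feed B D α s k F (H := H) (n := n) a (f a)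
      fun j hj => by rw [hF j hj])
    have hqm : Measurable (q a) :=
      (measurable_condProb _ (D.measurableSet_alarmBy H)).comp
        ((State.measurable_detHist a).comp (measurable_virt feed B α s k n))
    simpa using mul_meas_ge_le_lintegral hqm 1
  calc P.real {ω | ∃ j < n, virtAlarm feed B D α s k ω j}
      ≤ P.real (⋃ a, {ω | 1 ≤ q a ω}) := measureReal_mono hsub
    _ ≤ ∑ a, P.real {ω | 1 ≤ q a ω} := measureReal_iUnion_fintype_le _
    _ ≤ ∑ _a : Fin A, δ := Finset.sum_le_sum fun a _ => hq a
    _ = A * δ := by simp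

/-- A change after `t₁` rounds is missed with small probability, jointly with the event that exactly
`n₀` samples of arm `a` precede it. -/
lemma prob_miss_le_of_length {t₁ n n₀ d : ℕ} (htn : t₁ ≤ n) (a : Fin A)
    (f₀ f₁ : ProbabilityMeasure ℝ) (h0 : ∀ j < t₁, F (s + j + 1) a = f₀)
    (h1 : ∀ j, t₁ ≤ j → j < n → F (s + j + 1) a = f₁) {δ : ℝ}
    (hδ : (lawChange f₀ f₁ (n₀ + 1)).real
      {x | ((n₀ + 1 + d : ℕ) : ℕ∞) ≤ D.alarmTime x} ≤ δ) :
    (Measure.infinitePi (fun t => roundLaw (F t))).real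
      {ω | ((virt feed B α s k ω t₁).detHist a).length = n₀ ∧
        n₀ + d ≤ ((virt feed B α s k ω n).detHist a).length ∧
        ¬ ∃ j < n, virtAlarm feed B D α s k ω j} ≤ δ := by
  classical
  set P := Measure.infinitePi (fun t => roundLaw (F t))
  let μ : ℕ → Measure ℝ := fun i =>
    ((if i + 1 < n₀ + 1 then f₀ else f₁ : ProbabilityMeasure ℝ) : Measure ℝ)
  have hμ0 : ∀ i < n₀, μ i = f₀ := fun i hi => by simp [μ, hi]
  have hμ1 : ∀ i, n₀ ≤ i → μ i = f₁ := fun i hi => by simp [μ, not_lt.2 hi]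
  let S : Set (ℕ → ℝ) := (D.alarmBy (n₀ + d))ᶜ
  have hS : MeasurableSet S := (D.measurableSet_alarmBy _).compl
  let q : List ℝ → ℝ≥0∞ := condProb μ S
  have hq : Measurable q := measurable_condProb μ hS
  -- Before the change, the event is lost once an `n₀ + 1`-st sample arrives.
  let qpre : List ℝ → ℝ≥0∞ := fun l => if l.length ≤ n₀ then q l else 0
  let qpost : List ℝ → ℝ≥0∞ := fun l => if n₀ ≤ l.length then q l else ⊤
  have hqpre : Measurable qpre := Measurable.ite (measurable_length measurableSet_Iic) hq
    measurable_const
  have hqpost : Measurable qpost := Measurable.ite (measurable_length measurableSet_Ici) hq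
    measurable_const
  have hpre : ∀ j ≤ t₁, ∫⁻ ω, qpre ((virt feed B α s k ω j).detHist a) ∂P
      ≤ Measure.infinitePi μ S := by
    intro j
    induction j with
    | zero =>
      intro _
      simp only [virt, State.fresh, qpre, q, condProb_nil]
      simp [P]
    | succ j ih =>
      intro hj
      refine le_trans ?_ (ih (by omega))
      have := lintegral_detHist_step feed B α s k F j a (w := fun _ => 1) measurable_const
        (fun _ _ _ => rfl) (Q := qpre) hqpre (fun _ => le_rfl) (fun l => by
          rw [h0 j (by omega)]
          rcases lt_or_ge l.length n₀ with hl | hl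
          · have e1 : ∀ x : ℝ, qpre (l ++ [x]) = q (l ++ [x]) := fun x => by
              simp only [qpre, List.length_append, List.length_singleton]
              rw [if_pos (by omega)]
            have e2 : qpre l = q l := if_pos hl.le
            simp only [e1, e2, ← hμ0 _ hl]
            exact (lintegral_condProb_append μ hS l).le
          · have e1 : ∀ x : ℝ, qpre (l ++ [x]) = 0 := fun x => by
              simp only [qpre, List.length_append, List.length_singleton]
              rw [if_neg (by omega)]
            simp [e1])
      simpa only [one_mul] using this
  let w : (ℕ → Round A) → ℝ≥0∞ := fun ω =>
    if ((virt feed B α s k ω t₁).detHist a).length = n₀ then 1 else 0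
  have hw : Measurable w := Measurable.ite
    ((measurable_length.comp ((State.measurable_detHist a).comp
      (measurable_virt feed B α s k t₁))) (measurableSet_singleton n₀))
    measurable_const measurable_const
  have hpost : ∀ j, t₁ + j ≤ n →
      ∫⁻ ω, w ω * qpost ((virt feed B α s k ω (t₁ + j)).detHist a) ∂P
        ≤ Measure.infinitePi μ S := by
    intro j
    induction j with
    | zero =>
      intro _
      refine le_trans (lintegral_mono fun ω => ?_) (hpre t₁ le_rfl)
      by_cases hl : ((virt feed B α s k ω t₁).detHist a).length = n₀
      · simp [w, qpost, qpre, hl]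
      · simp [w, hl]
    | succ j ih =>
      intro hj
      refine le_trans ?_ (ih (by omega))
      refine lintegral_detHist_step feed B α s k F (t₁ + j) a hw (fun ω ω' h => ?_)
        hqpost (fun _ => le_rfl) (fun l => ?_)
      · have e : virt feed B α s k ω t₁ = virt feed B α s k ω' t₁ :=
          dependsOn_virt feed B α s k t₁ fun i hi => h i (by
            have := hi.2
            simp only [Set.mem_Iic]
            omega)
        simp only [w, e]
      · rw [h1 (t₁ + j) (by omega) (by omega)]
        rcases lt_or_ge l.length n₀ with hl | hl
        · have e2 : qpost l = ⊤ := if_neg (by omega)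
          simp [e2]
        · have e1 : ∀ x : ℝ, qpost (l ++ [x]) = q (l ++ [x]) := fun x => by
            simp only [qpost, List.length_append, List.length_singleton]
            rw [if_pos (by omega)]
          have e2 : qpost l = q l := if_pos hl
          simp only [e1, e2, ← hμ1 _ hl]
          exact (lintegral_condProb_append μ hS l).le
  have hfin := hpost (n - t₁) (by omega)
  rw [show t₁ + (n - t₁) = n by omega] at hfin
  have hset : {x | ((n₀ + 1 + d : ℕ) : ℕ∞) ≤ D.alarmTime x} = S := by
    ext x
    rw [show n₀ + 1 + d = n₀ + d + 1 by omega]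
    exact D.succ_le_alarmTime_iff (n₀ + d) x
  rw [hset] at hδ
  refine le_trans ?_ hδ
  have hprob : IsProbabilityMeasure (lawChange f₀ f₁ (n₀ + 1)) := by
    unfold lawChange; infer_instance
  refine ENNReal.toReal_mono (measure_ne_top _ _) (le_trans ?_ hfin)
  have hm : Measurable fun ω => w ω * qpost ((virt feed B α s k ω n).detHist a) :=
    hw.mul (hqpost.comp ((State.measurable_detHist a).comp (measurable_virt feed B α s k n)))
  refine le_trans (measure_mono ?_) (by simpa using mul_meas_ge_le_lintegral hm 1)
  rintro ω ⟨e1, e2, e3⟩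
  have hno : ∀ l', l' <+: (virt feed B α s k ω n).detHist a → l' ≠ [] → ¬ D.alarm l' :=
    fun l' g1 g2 g3 => e3 ((exists_virtAlarm_iff feed B D α s k ω n).2 ⟨a, l', g1, g2, g3⟩)
  have e4 : q ((virt feed B α s k ω n).detHist a) = 1 :=
    condProb_of_forall _ fun x => D.splice_notMem_alarmBy e2 hno x
  have e5 : n₀ ≤ ((virt feed B α s k ω n).detHist a).length := by omega
  simp [w, e1, qpost, e4, e5]

end Detection

/-! ### Missed detections over all sample counts -/

section Miss

variable {A : ℕ} (feed : DetectorFeed) (B : BanditAlg A) (D : DetectionRule) (α : ℕ → ℝ) (s k : ℕ)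
  (F : ℕ → Fin A → ProbabilityMeasure ℝ)

/-- Bound on the number of values that the pre-change number of samples of an arm may take in a
horizon `H`: it is deterministic if only forced samples are used. -/
def feedFactor (H : ℕ) : DetectorFeed → ℕ
  | .forcedOnly => 1
  | .allSamples => H

/-- A change of the law of arm `a` after `t₁` rounds is detected within `d` exploration cycles, if
`m` cycles precede it. -/
lemma prob_miss_le {t₁ m d H : ℕ} (a : Fin A) (f₀ f₁ : ProbabilityMeasure ℝ)
    (hL : A ≤ ⌈(A : ℝ) / α k⌉₊) (hm : ⌈(A : ℝ) / α k⌉₊ * m ≤ t₁) (hH : t₁ + 1 + d ≤ H)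
    (h0 : ∀ j < t₁, F (s + j + 1) a = f₀)
    (h1 : ∀ j, t₁ ≤ j → j < t₁ + ⌈(A : ℝ) / α k⌉₊ * d → F (s + j + 1) a = f₁) {δ : ℝ} (hδ0 : 0 ≤ δ)
    (hδ : ∀ ν, m + 1 ≤ ν → ν ≤ H - d → (lawChange f₀ f₁ ν).real
      {x | ((ν + d : ℕ) : ℕ∞) ≤ D.alarmTime x} ≤ δ) :
    (Measure.infinitePi (fun t => roundLaw (F t))).real
      {ω | ¬ ∃ j < t₁ + ⌈(A : ℝ) / α k⌉₊ * d, virtAlarm feed B D α s k ω j}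
        ≤ feedFactor H feed * δ := by
  set P := Measure.infinitePi (fun t => roundLaw (F t))
  set L := ⌈(A : ℝ) / α k⌉₊ with hLdef
  have hlow : ∀ ω, m ≤ ((virt feed B α s k ω t₁).detHist a).length := fun ω => by
    have e1 := length_detHist_add_cycles feed B α s k ω 0 m a hL
    have e2 := length_detHist_mono feed B α s k ω a hm
    simp only [Nat.zero_add] at e1 e2
    rw [← hLdef] at e1
    omega
  -- The event is covered by the possible values of the pre-change number of samples.
  have key : ∀ N : Finset ℕ, (∀ n ∈ N, m ≤ n ∧ n ≤ t₁) →
      (∀ ω, ((virt feed B α s k ω t₁).detHist a).length ∈ N) →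
      P.real {ω | ¬ ∃ j < t₁ + L * d, virtAlarm feed B D α s k ω j} ≤ N.card * δ := by
    intro N hN hmem
    have hsub : {ω | ¬ ∃ j < t₁ + L * d, virtAlarm feed B D α s k ω j} ⊆
        ⋃ n₀ ∈ N, {ω | ((virt feed B α s k ω t₁).detHist a).length = n₀ ∧
          n₀ + d ≤ ((virt feed B α s k ω (t₁ + L * d)).detHist a).length ∧
          ¬ ∃ j < t₁ + L * d, virtAlarm feed B D α s k ω j} := by
      intro ω hω
      refine Set.mem_biUnion (hmem ω) ⟨rfl, ?_, hω⟩
      exact length_detHist_add_cycles feed B α s k ω t₁ d a hL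
    refine (measureReal_mono hsub (measure_ne_top P _)).trans ((measureReal_biUnion_finset_le _ _).trans ?_)
    rw [← nsmul_eq_mul]
    refine Finset.sum_le_card_nsmul _ _ _ fun n₀ hn₀ => ?_
    have := hN n₀ hn₀
    exact prob_miss_le_of_length feed B D α s k F (Nat.le_add_right _ _) a f₀ f₁ h0 h1
      (hδ (n₀ + 1) (by omega) (by omega))
  cases feed with
  | forcedOnly =>
    let ω₀ : ℕ → Round A := fun _ => (0, fun _ => 0)
    have h := key {((virt .forcedOnly B α s k ω₀ t₁).detHist a).length}
      (fun n hn => by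
        rw [Finset.mem_singleton] at hn
        subst hn
        exact ⟨hlow ω₀, length_detHist_le _ _ _ _ _ _ _ _⟩)
      (fun ω => by
        rw [Finset.mem_singleton]
        exact length_detHist_forcedOnly B α s k ω ω₀ t₁ a)
    simpa [feedFactor] using h
  | allSamples =>
    refine (key (Finset.Icc m t₁) (fun n hn => Finset.mem_Icc.1 hn) (fun ω => Finset.mem_Icc.2
      ⟨hlow ω, length_detHist_le _ _ _ _ _ _ _ _⟩)).trans ?_
    refine mul_le_mul_of_nonneg_right ?_ hδ0
    rw [Nat.card_Icc]
    simp only [feedFactor]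
    exact_mod_cast (by omega)

end Miss

/-! ### The cost of a stationary stretch -/

section Gap

variable {A : ℕ} (F : Fin A → ProbabilityMeasure ℝ)

lemma gap_nonneg (a : Fin A) : 0 ≤ gap F a :=
  sub_nonneg.2 (le_ciSup (f := fun b => mean (F b)) (Set.finite_range _).bddAbove a)

end Gap

section Bandit

variable {A : ℕ} (B : BanditAlg A) (F : Fin A → ProbabilityMeasure ℝ)

lemma measurable_hist (n : ℕ) : Measurable fun ω => B.hist ω n := by
  have : Nonempty (Fin A) := ⟨B.act [] 0⟩
  induction n with
  | zero => exact measurable_const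
  | succ n ih =>
    have ha : Measurable fun ω : ℕ → Round A => B.act (B.hist ω n) (ω n).1 :=
      (State.measurable_act B).comp (ih.prodMk (measurable_fst.comp (measurable_pi_apply n)))
    refine measurable_append_singleton.comp (ih.prodMk (ha.prodMk ?_))
    exact measurable_apply_index ha (f := fun b (ω : ℕ → Round A) => (ω n).2 b) fun b =>
      (measurable_pi_apply b).comp (measurable_snd.comp (measurable_pi_apply n))

lemma measurable_hist_act (n : ℕ) :
    Measurable fun ω : ℕ → Round A => B.act (B.hist ω n) (ω n).1 :=
  (State.measurable_act B).comp
    ((measurable_hist B n).prodMk (measurable_fst.comp (measurable_pi_apply n)))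

lemma dependsOn_hist (n : ℕ) : DependsOn (fun ω => B.hist ω n) (Set.Iio n) := by
  induction n with
  | zero => intro _ _ _; rfl
  | succ n ih =>
    intro ω ω' h
    have h1 : B.hist ω n = B.hist ω' n := ih fun i hi => h i (Set.mem_Iio.2 (by
      have := Set.mem_Iio.1 hi; omega))
    have h2 : ω n = ω' n := h _ (Set.mem_Iio.2 (by omega))
    simp only [BanditAlg.hist, h1, h2]

lemma measurable_sum_gap_hist (n : ℕ) :
    Measurable fun ω => ∑ i ∈ Finset.range n, gap F (B.act (B.hist ω i) (ω i).1) :=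
  Finset.measurable_fun_sum _ fun i _ =>
    (measurable_of_countable (gap F)).comp (measurable_hist_act B i)

lemma abs_gap_le_sum (a : Fin A) : |gap F a| ≤ ∑ b, gap F b := by
  rw [abs_of_nonneg (gap_nonneg F a)]
  exact Finset.single_le_sum (fun b _ => gap_nonneg F b) (Finset.mem_univ a)

lemma integrable_gap_comp {Ω : Type*} [MeasurableSpace Ω] (μ : Measure Ω) [IsFiniteMeasure μ]
    {a : Ω → Fin A} (ha : Measurable a) : Integrable (fun ω => gap F (a ω)) μ :=
  Integrable.of_bound ((measurable_of_countable (gap F)).comp ha).aestronglyMeasurable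
    (∑ b, gap F b) (ae_of_all _ fun _ => abs_gap_le_sum F _)

lemma regret_mono : Monotone (B.regret F) := by
  intro n m h
  refine integral_mono ?_ ?_ fun ω => ?_
  · exact integrable_finsetSum _ fun i _ => integrable_gap_comp F _ (measurable_hist_act B i)
  · exact integrable_finsetSum _ fun i _ => integrable_gap_comp F _ (measurable_hist_act B i)
  · exact Finset.sum_le_sum_of_subset_of_nonneg (Finset.range_mono h)
      fun i _ _ => gap_nonneg F _

end Bandit

section Stretch

variable {A : ℕ} (feed : DetectorFeed) (B : BanditAlg A) (α : ℕ → ℝ) (s k : ℕ)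

/-- In the `j + 1`-st round after a restart with interval number `k` the bandit algorithm plays. -/
def isFree (A : ℕ) (α : ℕ → ℝ) (k j : ℕ) : Prop := A ≤ j % ⌈(A : ℝ) / α k⌉₊

noncomputable instance (A : ℕ) (α : ℕ → ℝ) (k : ℕ) : DecidablePred (isFree A α k) := fun j =>
  inferInstanceAs (Decidable (A ≤ j % ⌈(A : ℝ) / α k⌉₊))

/-- The bandit algorithm, which ignores the forced rounds, runs as if alone on the subsequence of
the other rounds. -/
lemma virt_banHist (ω : ℕ → Round A) (n : ℕ) :
    (virt feed B α s k ω n).banHist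
      = B.hist (fun i => ω (s + Nat.nth (isFree A α k) i + 1)) (Nat.count (isFree A α k) n) := by
  induction n with
  | zero => simp [virt, State.fresh, BanditAlg.hist]
  | succ n ih =>
    by_cases h : isFree A α k n
    · have hn : ¬ (virt feed B α s k ω n).slot α (s + n + 1) < A := by
        rw [virt_slot]; exact not_lt.2 h
      simp only [virt, State.extend]
      rw [if_neg hn, Nat.count_succ, if_pos h]
      simp only [BanditAlg.hist, State.arm]
      rw [dif_neg hn, Nat.nth_count h, ih]
    · have hn : (virt feed B α s k ω n).slot α (s + n + 1) < A := by
        rw [virt_slot]; exact not_le.1 h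
      simp only [virt, State.extend]
      rw [if_pos hn, Nat.count_succ, if_neg h, ih, Nat.add_zero]

lemma virtArm_of_isFree (ω : ℕ → Round A) {n : ℕ} (h : isFree A α k n) :
    virtArm feed B α s k ω n
      = B.act (B.hist (fun i => ω (s + Nat.nth (isFree A α k) i + 1)) (Nat.count (isFree A α k) n))
          (ω (s + Nat.nth (isFree A α k) (Nat.count (isFree A α k) n) + 1)).1 := by
  have hn : ¬ (virt feed B α s k ω n).slot α (s + n + 1) < A := by
    rw [virt_slot]; exact not_lt.2 h
  unfold virtArm State.arm
  rw [dif_neg hn, Nat.nth_count h, virt_banHist]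

lemma sum_gap_free (f : Fin A → ProbabilityMeasure ℝ) (ω : ℕ → Round A) (n : ℕ) :
    ∑ j ∈ (Finset.range n).filter (isFree A α k), gap f (virtArm feed B α s k ω j)
      = (fun ω' : ℕ → Round A => ∑ i ∈ Finset.range (Nat.count (isFree A α k) n),
          gap f (B.act (B.hist ω' i) (ω' i).1))
            (fun i => ω (s + Nat.nth (isFree A α k) i + 1)) := by
  simp only
  induction n with
  | zero => simp
  | succ n ih =>
    by_cases h : isFree A α k n
    · rw [Finset.range_add_one, Finset.filter_insert, if_pos h, Finset.sum_insert (by simp),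
        Nat.count_succ, if_pos h, Finset.sum_range_succ, ← ih, virtArm_of_isFree _ _ _ _ _ _ h,
        add_comm]
    · rw [Finset.range_add_one, Finset.filter_insert, if_neg h, Nat.count_succ, if_neg h, ih,
        Nat.add_zero]

variable (F : ℕ → Fin A → ProbabilityMeasure ℝ)

/-- The cost of the free rounds in a stationary stretch is the regret of the bandit algorithm over
as many rounds. -/
lemma integral_sum_gap_free (f : Fin A → ProbabilityMeasure ℝ) {n : ℕ}
    (hF : ∀ j < n, F (s + j + 1) = f) (hL0 : 0 < ⌈(A : ℝ) / α k⌉₊) :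
    ∫ ω, ∑ j ∈ (Finset.range n).filter (isFree A α k), gap f (virtArm feed B α s k ω j)
        ∂Measure.infinitePi (fun t => roundLaw (F t))
      = B.regret f (Nat.count (isFree A α k) n) := by
  simp only [sum_gap_free]
  rcases le_or_gt ⌈(A : ℝ) / α k⌉₊ A with hL | hL
  · -- If the cycle has no free round, then both sides vanish.
    have hno : ∀ j, ¬ isFree A α k j := by
      intro j hj
      unfold isFree at hj
      have := Nat.mod_lt j hL0
      omega
    have hc : Nat.count (isFree A α k) n = 0 := by
      rw [Nat.count_eq_card_filter_range, Finset.card_eq_zero]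
      exact Finset.filter_false_of_mem fun j _ => hno j
    simp [hc, BanditAlg.regret]
  · have hinf : {j | isFree A α k j}.Infinite := by
      refine Set.infinite_of_forall_exists_gt fun j => ⟨⌈(A : ℝ) / α k⌉₊ * (j + 1) + A, ?_, ?_⟩
      · show A ≤ _ % _
        rw [Nat.mul_add_mod, Nat.mod_eq_of_lt hL]
      · have : 1 * (j + 1) ≤ ⌈(A : ℝ) / α k⌉₊ * (j + 1) := Nat.mul_le_mul_right _ (by omega)
        omega
    refine integral_infinitePi_reindex (fun t => roundLaw (F t)) (fun _ => roundLaw f)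
      (e := fun i => s + Nat.nth (isFree A α k) i + 1) ?_ (Set.Iio (Nat.count (isFree A α k) n))
      ?_ (measurable_sum_gap_hist B f _) ?_
    · intro i j hij
      simp only at hij
      have hinj : Function.Injective (Nat.nth (isFree A α k)) := Nat.nth_injective hinf
      exact hinj (by omega)
    · intro i hi
      rw [hF _ (Nat.nth_lt_of_lt_count (Set.mem_Iio.1 hi))]
    · intro ω ω' h
      refine Finset.sum_congr rfl fun i hi => ?_
      have hi' := Finset.mem_range.1 hi
      have h1 : B.hist ω i = B.hist ω' i := dependsOn_hist B i fun j hj =>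
        h j (Set.mem_Iio.2 (lt_trans (Set.mem_Iio.1 hj) hi'))
      rw [h1, h i (Set.mem_Iio.2 hi')]

lemma card_forced_le (n : ℕ) :
    ((Finset.range n).filter fun j => ¬ isFree A α k j).card ≤ A * (n / ⌈(A : ℝ) / α k⌉₊ + 1) := by
  set L := ⌈(A : ℝ) / α k⌉₊ with hLdef
  have : (Finset.range A ×ˢ Finset.range (n / L + 1)).card = A * (n / L + 1) := by simp
  rw [← this]
  refine Finset.card_le_card_of_injOn (fun j => (j % L, j / L)) ?_ ?_
  · intro j hj
    simp only [Finset.coe_filter, Finset.mem_range, Set.mem_ofPred_eq, isFree, not_le,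
      ← hLdef] at hj
    simp only [Finset.coe_product, Finset.coe_range, Set.mem_prod, Set.mem_Iio]
    exact ⟨hj.2, Nat.lt_succ_of_le (Nat.div_le_div_right hj.1.le)⟩
  · intro i _ j _ hij
    simp only [Prod.mk.injEq] at hij
    rw [← Nat.div_add_mod i L, ← Nat.div_add_mod j L, hij.1, hij.2]

/-- The expected cost of the `n` rounds after a restart in a stationary stretch: forced exploration
and the regret of the bandit algorithm. -/
lemma integral_sum_gap_virtArm_le (f : Fin A → ProbabilityMeasure ℝ) {n : ℕ}
    (hF : ∀ j < n, F (s + j + 1) = f) {C : ℝ} (hC : ∀ a, gap f a ≤ C)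
    (hL : 0 < ⌈(A : ℝ) / α k⌉₊) :
    ∫ ω, ∑ j ∈ Finset.range n, gap f (virtArm feed B α s k ω j)
        ∂Measure.infinitePi (fun t => roundLaw (F t))
      ≤ C * (A * (n / ⌈(A : ℝ) / α k⌉₊ + 1 : ℕ)) + B.regret f n := by
  have hC0 : 0 ≤ C := (gap_nonneg f (B.act [] 0)).trans (hC _)
  set P := Measure.infinitePi (fun t => roundLaw (F t))
  have hint : ∀ t : Finset ℕ,
      Integrable (fun ω => ∑ j ∈ t, gap f (virtArm feed B α s k ω j)) P :=
    fun t => integrable_finsetSum _ fun j _ =>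
      integrable_gap_comp f _ (measurable_virtArm feed B α s k j)
  calc ∫ ω, ∑ j ∈ Finset.range n, gap f (virtArm feed B α s k ω j) ∂P
      ≤ ∫ ω, (C * (A * (n / ⌈(A : ℝ) / α k⌉₊ + 1 : ℕ))
          + ∑ j ∈ (Finset.range n).filter (isFree A α k), gap f (virtArm feed B α s k ω j)) ∂P := by
        refine integral_mono (hint _) ((integrable_const _).add (hint _)) fun ω => ?_
        simp only
        rw [← Finset.sum_filter_not_add_sum_filter (Finset.range n) (isFree A α k)]
        gcongr
        refine (Finset.sum_le_card_nsmul _ _ C fun j _ => hC _).trans ?_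
        rw [nsmul_eq_mul, mul_comm]
        gcongr
        exact_mod_cast card_forced_le α k n
    _ = C * (A * (n / ⌈(A : ℝ) / α k⌉₊ + 1 : ℕ)) + B.regret f (Nat.count (isFree A α k) n) := by
        rw [integral_add (integrable_const _) (hint _), integral_sum_gap_free feed B α s k F f hF hL]
        simp
    _ ≤ _ := by
        gcongr
        refine regret_mono B f ?_
        rw [Nat.count_eq_card_filter_range]
        exact (Finset.card_filter_le _ _).trans (by simp)

end Stretch

/-! ### From one interval to the next -/

section Intervals

variable {A : ℕ} (feed : DetectorFeed) (B : BanditAlg A) (D : DetectionRule) (α : ℕ → ℝ)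

/-- The procedure restarts at time `s` with interval number `k`. -/
def restartAt (k s : ℕ) : Set (ℕ → Round A) :=
  {ω | state feed B D α ω s = State.fresh A s k}

/-- The procedure restarts with interval number `k` at one of the times `lo,…,hi`. -/
def restartIn (k lo hi : ℕ) : Set (ℕ → Round A) :=
  {ω | ∃ s ∈ Finset.Icc lo hi, ω ∈ restartAt feed B D α k s}

lemma measurableSet_restartAt (k s : ℕ) : MeasurableSet (restartAt feed B D α k s) := by
  have e : restartAt feed B D α k s = {ω | (state feed B D α ω s).τ = s} ∩
      ({ω | (state feed B D α ω s).k = k} ∩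
        ({ω | ∀ a, ((state feed B D α ω s).detHist a).length = 0} ∩
          {ω | ((state feed B D α ω s).banHist).length = 0})) := by
    ext ω
    simp only [restartAt, Set.mem_ofPred_eq, Set.mem_inter_iff, List.length_eq_zero_iff]
    constructor
    · intro h
      rw [h]
      simp [State.fresh]
    · rintro ⟨h1, h2, h3, h4⟩
      have h5 := funext h3
      generalize state feed B D α ω s = st at *
      cases st
      simp only [State.fresh, State.mk.injEq] at *
      exact ⟨h1, h2, h5, h4⟩
  rw [e]
  have hm := measurable_state feed B D α s
  refine ((State.measurable_τ.comp hm) (measurableSet_singleton s)).inter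
    (((State.measurable_k.comp hm) (measurableSet_singleton k)).inter (MeasurableSet.inter ?_
      ((measurable_length.comp (State.measurable_banHist.comp hm)) (measurableSet_singleton 0))))
  have : {ω | ∀ a, ((state feed B D α ω s).detHist a).length = 0}
      = ⋂ a, {ω | ((state feed B D α ω s).detHist a).length = 0} := by
    ext ω
    simp
  rw [this]
  exact MeasurableSet.iInter fun a =>
    (measurable_length.comp ((State.measurable_detHist a).comp hm)) (measurableSet_singleton 0)

lemma restartIn_eq (k lo hi : ℕ) :
    restartIn feed B D α k lo hi = ⋃ s ∈ Finset.Icc lo hi, restartAt feed B D α k s := by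
  ext ω
  simp [restartIn]

lemma measurableSet_restartIn (k lo hi : ℕ) : MeasurableSet (restartIn feed B D α k lo hi) := by
  rw [restartIn_eq]
  exact Finset.measurableSet_biUnion _ fun s _ => measurableSet_restartAt feed B D α k s

lemma dependsOn_indicator_restartAt (k s : ℕ) :
    DependsOn ((restartAt feed B D α k s).indicator (1 : (ℕ → Round A) → ℝ)) (Set.Iic s) := by
  classical
  intro ω ω' h
  have h1 : state feed B D α ω s = state feed B D α ω' s := dependsOn_state feed B D α s h
  simp only [Set.indicator_apply, restartAt, Set.mem_ofPred_eq, h1, Pi.one_apply]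

variable (F : ℕ → Fin A → ProbabilityMeasure ℝ)

/-- The rounds after a restart are independent of it. Hence a bound on the expectation of a function
of these rounds, uniform in the time of the restart, holds for a random restart as well. -/
lemma sum_integral_restartAt_le (k lo hi : ℕ) {g : ℕ → (ℕ → Round A) → ℝ}
    (hg : ∀ s, Measurable (g s)) (hgd : ∀ s, DependsOn (g s) (Set.Ioi s)) {V : ℝ} (hV : 0 ≤ V)
    (hgV : ∀ s ∈ Finset.Icc lo hi, ∫ ω, g s ω ∂Measure.infinitePi (fun t => roundLaw (F t)) ≤ V) :
    ∑ s ∈ Finset.Icc lo hi, ∫ ω, (restartAt feed B D α k s).indicator 1 ω * g s ω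
        ∂Measure.infinitePi (fun t => roundLaw (F t)) ≤ V := by
  set P := Measure.infinitePi (fun t => roundLaw (F t))
  have h1 : ∀ s ∈ Finset.Icc lo hi,
      ∫ ω, (restartAt feed B D α k s).indicator 1 ω * g s ω ∂P
        ≤ P.real (restartAt feed B D α k s) * V := by
    intro s hs
    rw [integral_infinitePi_mul (fun t => roundLaw (F t)) (Set.Iic s)
      (measurable_one.indicator (measurableSet_restartAt feed B D α k s)) (hg s)
      (dependsOn_indicator_restartAt feed B D α k s) (by rw [Set.compl_Iic]; exact hgd s),
      integral_indicator_one (measurableSet_restartAt feed B D α k s)]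
    exact mul_le_mul_of_nonneg_left (hgV s hs) measureReal_nonneg
  refine (Finset.sum_le_sum h1).trans ?_
  rw [← Finset.sum_mul, ← measureReal_biUnion_finset]
  · exact mul_le_of_le_one_left hV measureReal_le_one
  · intro s _ s' _ hne
    refine Set.disjoint_left.2 fun ω h h' => hne ?_
    exact fresh_time_unique feed B α h h'
  · exact fun s _ => measurableSet_restartAt feed B D α k s

lemma dependsOn_exists_virtAlarm (s k n : ℕ) :
    DependsOn (fun ω => ∃ j < n, virtAlarm feed B D α s k ω j) (Set.Ioi s) := by
  intro ω ω' h
  simp only [eq_iff_iff]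
  refine exists_congr fun j => and_congr_right fun _ => ?_
  have := dependsOn_virtAlarm feed B D α s k j (x := ω) (y := ω')
    fun i hi => h i (Set.mem_Ioi.2 hi.1)
  exact iff_of_eq this

/-- If the `k`-th interval is entered in time, then so is the next one, unless there is a false alarm
before the change or the change is not detected within `c` rounds. -/
lemma prob_not_restartIn_succ_le (k lo hi e c : ℕ) (hhi : hi ≤ e) {p q : ℝ} (hp : 0 ≤ p)
    (hq : 0 ≤ q)
    (hfalse : ∀ s ∈ Finset.Icc lo hi, (Measure.infinitePi (fun t => roundLaw (F t))).real
      {ω | ∃ j < e - s, virtAlarm feed B D α s k ω j} ≤ p)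
    (hmiss : ∀ s ∈ Finset.Icc lo hi, (Measure.infinitePi (fun t => roundLaw (F t))).real
      {ω | ¬ ∃ j < e - s + c, virtAlarm feed B D α s k ω j} ≤ q) :
    (Measure.infinitePi (fun t => roundLaw (F t))).real
        (restartIn feed B D α (k + 1) e (e + c))ᶜ
      ≤ (Measure.infinitePi (fun t => roundLaw (F t))).real (restartIn feed B D α k lo hi)ᶜ
        + (p + q) := by
  classical
  set P := Measure.infinitePi (fun t => roundLaw (F t))
  let bad : ℕ → Set (ℕ → Round A) := fun s =>
    {ω | ∃ j < e - s, virtAlarm feed B D α s k ω j} ∪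
      {ω | ¬ ∃ j < e - s + c, virtAlarm feed B D α s k ω j}
  have hbad : ∀ s, MeasurableSet (bad s) := fun s =>
    (measurableSet_exists_virtAlarm feed B D α s k _).union
      (measurableSet_exists_virtAlarm feed B D α s k _).compl
  have hsub : (restartIn feed B D α (k + 1) e (e + c))ᶜ ⊆ (restartIn feed B D α k lo hi)ᶜ ∪
      ⋃ s ∈ Finset.Icc lo hi, (restartAt feed B D α k s ∩ bad s) := by
    intro ω hω
    by_contra hcon
    simp only [Set.mem_union, not_or, Set.mem_compl_iff, not_not, Set.mem_iUnion, not_exists,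
      Set.mem_inter_iff, not_and] at hcon hω
    obtain ⟨⟨s, hs, hr⟩, hnb⟩ := hcon
    have hnb := hnb s hs hr
    simp only [bad, Set.mem_union, Set.mem_ofPred_eq, not_or, not_not] at hnb
    obtain ⟨hnf, hex⟩ := hnb
    -- The first alarm is raised in the allowed window.
    have hex' : ∃ j, virtAlarm feed B D α s k ω j := by
      obtain ⟨j, -, hj⟩ := hex
      exact ⟨j, hj⟩
    have h1 : Nat.find hex' < e - s + c := by
      obtain ⟨j, hj1, hj2⟩ := hex
      exact (Nat.find_min' hex' hj2).trans_lt hj1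
    have h2 : e - s ≤ Nat.find hex' := by
      by_contra hlt
      exact hnf ⟨_, not_le.1 hlt, Nat.find_spec hex'⟩
    have hsle := (Finset.mem_Icc.1 hs).2
    refine hω ⟨s + Nat.find hex' + 1, Finset.mem_Icc.2 ⟨by omega, by omega⟩, ?_⟩
    exact state_of_first_alarm feed B α hr (fun j hj => Nat.find_min hex' hj)
      (Nat.find_spec hex')
  refine (measureReal_mono hsub (measure_ne_top P _)).trans ((measureReal_union_le _ _).trans ?_)
  gcongr
  refine (measureReal_biUnion_finset_le _ _).trans ?_
  have h3 : ∀ s, P.real (restartAt feed B D α k s ∩ bad s)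
      = ∫ ω, (restartAt feed B D α k s).indicator 1 ω * (bad s).indicator 1 ω ∂P := by
    intro s
    rw [← integral_indicator_one ((measurableSet_restartAt feed B D α k s).inter (hbad s)),
      Set.inter_indicator_one]
    rfl
  simp only [h3]
  refine sum_integral_restartAt_le feed B D α F k lo hi
    (fun s => measurable_one.indicator (hbad s)) (fun s ω ω' h => ?_) (by positivity)
    fun s hs => ?_
  · have e1 := dependsOn_exists_virtAlarm feed B D α s k (e - s) h
    have e2 := dependsOn_exists_virtAlarm feed B D α s k (e - s + c) h
    simp only at e1 e2
    simp only [Set.indicator_apply, bad, Set.mem_union, Set.mem_ofPred_eq, e1, e2, Pi.one_apply]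
  · rw [integral_indicator_one (hbad s)]
    exact (measureReal_union_le _ _).trans (add_le_add (hfalse s hs) (hmiss s hs))

/-- Expected cost of the rounds `b,…,e` of a stationary interval: the delay `c` after which the
procedure restarts, the probability that it does not, that of a false alarm, and the cost after the
restart. -/
lemma integral_interval_le (f : Fin A → ProbabilityMeasure ℝ) {C : ℝ} (hC : ∀ a, gap f a ≤ C)
    (k b c e : ℕ) {p V : ℝ} (hp : 0 ≤ p) (hV : 0 ≤ V) (hb : 1 ≤ b)
    (hfalse : ∀ s ∈ Finset.Icc (b - 1) (b - 1 + c),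
      (Measure.infinitePi (fun t => roundLaw (F t))).real
        {ω | ∃ j < e - s, virtAlarm feed B D α s k ω j} ≤ p)
    (hcost : ∀ s ∈ Finset.Icc (b - 1) (b - 1 + c),
      ∫ ω, ∑ j ∈ Finset.range (e - s), gap f (virtArm feed B α s k ω j)
        ∂Measure.infinitePi (fun t => roundLaw (F t)) ≤ V) :
    ∫ ω, ∑ t ∈ Finset.Ico b (e + 1), gap f (playedArm feed B D α ω t)
        ∂Measure.infinitePi (fun t => roundLaw (F t))
      ≤ C * c + C * (e + 1 - b : ℕ) * ((Measure.infinitePi (fun t => roundLaw (F t))).real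
          (restartIn feed B D α k (b - 1) (b - 1 + c))ᶜ + p) + V := by
  classical
  have hC0 : 0 ≤ C := (gap_nonneg f (B.act [] 0)).trans (hC _)
  set P := Measure.infinitePi (fun t => roundLaw (F t))
  set G := restartIn feed B D α k (b - 1) (b - 1 + c) with hG
  have hGm : MeasurableSet G := measurableSet_restartIn feed B D α k _ _
  let n : ℝ := (e + 1 - b : ℕ)
  have hn0 : 0 ≤ n := Nat.cast_nonneg _
  let fa : ℕ → Set (ℕ → Round A) := fun s => {ω | ∃ j < e - s, virtAlarm feed B D α s k ω j}
  have hfa : ∀ s, MeasurableSet (fa s) := fun s => measurableSet_exists_virtAlarm feed B D α s k _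
  let Y : ℕ → (ℕ → Round A) → ℝ := fun s ω =>
    ∑ j ∈ Finset.range (e - s), gap f (virtArm feed B α s k ω j)
  have hY0 : ∀ s ω, 0 ≤ Y s ω := fun s ω => Finset.sum_nonneg fun j _ => gap_nonneg f _
  have hYint : ∀ s, Integrable (Y s) P := fun s => integrable_finsetSum _ fun j _ =>
    integrable_gap_comp f _ (measurable_virtArm feed B α s k j)
  have hYm : ∀ s, Measurable (Y s) := fun s => Finset.measurable_fun_sum _ fun j _ =>
    (measurable_of_countable (gap f)).comp (measurable_virtArm feed B α s k j)
  let g : ℕ → (ℕ → Round A) → ℝ := fun s ω => C * n * (fa s).indicator 1 ω + Y s ω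
  have hind : ∀ s ω, 0 ≤ (fa s).indicator (1 : (ℕ → Round A) → ℝ) ω := fun s ω =>
    Set.indicator_nonneg (fun _ _ => zero_le_one) ω
  have hg0 : ∀ s ω, 0 ≤ g s ω := fun s ω =>
    add_nonneg (mul_nonneg (mul_nonneg hC0 hn0) (hind s ω)) (hY0 s ω)
  have hindint : ∀ S : Set (ℕ → Round A), MeasurableSet S →
      Integrable (S.indicator (1 : (ℕ → Round A) → ℝ)) P := fun S hS =>
    (integrable_const (1 : ℝ)).indicator hS
  have hgint : ∀ s, Integrable (g s) P := fun s =>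
    ((hindint _ (hfa s)).const_mul _).add (hYint s)
  have hgm : ∀ s, Measurable (g s) := fun s =>
    ((measurable_one.indicator (hfa s)).const_mul _).add (hYm s)
  have hrgint : ∀ s, Integrable
      (fun ω => (restartAt feed B D α k s).indicator 1 ω * g s ω) P := fun s => by
    have : (fun ω => (restartAt feed B D α k s).indicator 1 ω * g s ω)
        = (restartAt feed B D α k s).indicator (g s) := by
      funext ω
      by_cases h : ω ∈ restartAt feed B D α k s <;> simp [h]
    rw [this]
    exact (hgint s).indicator (measurableSet_restartAt feed B D α k s)
  have hall : ∀ ω, ∑ t ∈ Finset.Ico b (e + 1), gap f (playedArm feed B D α ω t) ≤ C * n := by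
    intro ω
    refine (Finset.sum_le_card_nsmul _ _ C fun t _ => hC _).trans ?_
    rw [Nat.card_Ico, nsmul_eq_mul, mul_comm]
  -- On a restart at `s` without false alarm, the rounds up to `s` cost at most the delay.
  have hpt : ∀ ω, ∑ t ∈ Finset.Ico b (e + 1), gap f (playedArm feed B D α ω t)
      ≤ C * c + C * n * Gᶜ.indicator 1 ω + ∑ s ∈ Finset.Icc (b - 1) (b - 1 + c),
          (restartAt feed B D α k s).indicator 1 ω * g s ω := by
    intro ω
    have hsum0 : ∀ s ∈ Finset.Icc (b - 1) (b - 1 + c),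
        0 ≤ (restartAt feed B D α k s).indicator 1 ω * g s ω := fun s _ =>
      mul_nonneg (Set.indicator_nonneg (fun _ _ => zero_le_one) ω) (hg0 s ω)
    have hcc : 0 ≤ C * c := mul_nonneg hC0 (Nat.cast_nonneg _)
    by_cases hω : ω ∈ G
    · obtain ⟨s, hs, hr⟩ := hω
      have hle := Finset.single_le_sum hsum0 hs
      rw [Set.indicator_of_mem hr, Pi.one_apply, one_mul] at hle
      have hgc : 0 ≤ C * n * Gᶜ.indicator 1 ω :=
        mul_nonneg (mul_nonneg hC0 hn0) (Set.indicator_nonneg (fun _ _ => zero_le_one) ω)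
      suffices h : ∑ t ∈ Finset.Ico b (e + 1), gap f (playedArm feed B D α ω t)
          ≤ C * c + g s ω by linarith
      by_cases hf : ω ∈ fa s
      · have h1 := hall ω
        have h2 := hY0 s ω
        simp only [g, Set.indicator_of_mem hf, Pi.one_apply]
        linarith
      · simp only [g, Set.indicator_of_notMem hf, mul_zero, zero_add]
        have hs' := Finset.mem_Icc.1 hs
        have hno : ∀ j < e - s, ¬ virtAlarm feed B D α s k ω j := fun j hj ha => hf ⟨j, hj, ha⟩
        have hsplit : Finset.Ico b (e + 1) ⊆ Finset.Ico b (s + 1) ∪ Finset.Ico (s + 1) (e + 1) := by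
          intro t ht
          simp only [Finset.mem_union, Finset.mem_Ico] at ht ⊢
          omega
        have hdisj : Disjoint (Finset.Ico b (s + 1)) (Finset.Ico (s + 1) (e + 1)) :=
          Finset.Ico_disjoint_Ico_consecutive _ _ _
        refine (Finset.sum_le_sum_of_subset_of_nonneg hsplit
          fun t _ _ => gap_nonneg f _).trans ?_
        rw [Finset.sum_union hdisj]
        refine add_le_add ?_ (le_of_eq ?_)
        · refine (Finset.sum_le_card_nsmul _ _ C fun t _ => hC _).trans ?_
          rw [Nat.card_Ico, nsmul_eq_mul, mul_comm]
          gcongr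
          omega
        · rw [Finset.sum_Ico_eq_sum_range, show e + 1 - (s + 1) = e - s by omega]
          refine Finset.sum_congr rfl fun j hj => ?_
          rw [show s + 1 + j = s + j + 1 by omega, playedArm_eq_virtArm feed B α hr fun i hi =>
            hno i (hi.trans (Finset.mem_range.1 hj))]
    · have h1 := hall ω
      have h2 := Finset.sum_nonneg hsum0
      rw [Set.indicator_of_mem (show ω ∈ Gᶜ from hω), Pi.one_apply, mul_one]
      linarith
  have hint1 : Integrable (fun ω => C * c + C * n * Gᶜ.indicator 1 ω) P :=
    (integrable_const _).add ((hindint _ hGm.compl).const_mul _)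
  have hint2 : Integrable (fun ω => ∑ s ∈ Finset.Icc (b - 1) (b - 1 + c),
      (restartAt feed B D α k s).indicator 1 ω * g s ω) P :=
    integrable_finsetSum _ fun s _ => hrgint s
  refine (integral_mono (integrable_finsetSum _ fun t _ =>
    integrable_gap_comp f _ (measurable_playedArm feed B D α t)) (hint1.add hint2) hpt).trans ?_
  rw [integral_add' hint1 hint2, integral_add (integrable_const _)
    ((hindint _ hGm.compl).const_mul _), integral_const_mul (C * n), integral_indicator_one hGm.compl,
    integral_finsetSum _ fun s _ => hrgint s]
  have hlast := sum_integral_restartAt_le feed B D α F k (b - 1) (b - 1 + c) hgm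
    (fun s ω ω' h => ?_) (V := C * n * p + V) (by positivity) (fun s hs => ?_)
  · simp only [integral_const, probReal_univ, one_smul]
    change _ ≤ C * c + C * n * (P.real Gᶜ + p) + V
    have hlast' : ∑ s ∈ Finset.Icc (b - 1) (b - 1 + c),
        ∫ ω, (restartAt feed B D α k s).indicator 1 ω * g s ω ∂P ≤ C * n * p + V := hlast
    linarith
  · have e1 := dependsOn_exists_virtAlarm feed B D α s k (e - s) h
    simp only at e1
    have e2 : Y s ω = Y s ω' := Finset.sum_congr rfl fun j _ => by
      have := dependsOn_virtArm feed B α s k j (x := ω) (y := ω') fun i hi =>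
        h i (Set.mem_Ioi.2 hi.1)
      simp only at this
      rw [this]
    simp only [g, e2, fa, Set.indicator_apply, Set.mem_ofPred_eq, e1, Pi.one_apply]
  · simp only [g]
    rw [integral_add ((hindint _ (hfa s)).const_mul _) (hYint s), integral_const_mul,
      integral_indicator_one (hfa s)]
    exact add_le_add (mul_le_mul_of_nonneg_left (hfalse s hs) (mul_nonneg hC0 hn0)) (hcost s hs)

end Intervals

/-! ### The regret of the procedure, interval by interval -/

section Environment

variable {A T : ℕ} {σ : ℝ≥0} {C Δ : ℝ} (E : PSBandit A T σ C Δ)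

lemma PSBandit.ν_le {i j : ℕ} (hij : i ≤ j) (hj : j ≤ E.N + 1) : E.ν i ≤ E.ν j := by
  induction j, hij using Nat.le_induction with
  | base => exact le_rfl
  | succ j _ ih => exact (ih (by omega)).trans (E.ν_lt j (by omega)).le

lemma PSBandit.one_le_ν {i : ℕ} (hi : i ≤ E.N + 1) : 1 ≤ E.ν i := by
  rw [← E.ν_zero]
  exact E.ν_le (Nat.zero_le i) hi

lemma PSBandit.ν_le_succ {i : ℕ} (hi : i ≤ E.N + 1) : E.ν i ≤ T + 1 := by
  rw [← E.ν_last]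
  exact E.ν_le hi le_rfl

lemma PSBandit.interval_eq {k t : ℕ} (hk1 : 1 ≤ k) (hk : k ≤ E.N + 1) (h1 : E.ν (k - 1) ≤ t)
    (h2 : t < E.ν k) : E.interval t = k := by
  have : (Finset.Icc 1 E.N).filter (fun j => E.ν j ≤ t) = Finset.Icc 1 (k - 1) := by
    ext j
    simp only [Finset.mem_filter, Finset.mem_Icc]
    constructor
    · rintro ⟨⟨hj1, hj2⟩, hj3⟩
      refine ⟨hj1, ?_⟩
      by_contra hlt
      have := E.ν_le (show k ≤ j by omega) (by omega)
      omega
    · rintro ⟨hj1, hj2⟩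
      exact ⟨⟨hj1, by omega⟩, (E.ν_le hj2 (by omega)).trans h1⟩
  unfold PSBandit.interval
  rw [this, Nat.card_Icc]
  omega

variable (feed : DetectorFeed) (B : BanditAlg A) (D : DetectionRule) (α : ℕ → ℝ) {m d : ℕ} {δ : ℝ}

lemma PSBandit.prob_false_alarm_le {k s : ℕ} (hk1 : 1 ≤ k) (hk : k ≤ E.N + 1)
    (hs : E.ν (k - 1) - 1 ≤ s)
    (hF : ∀ f₀ : ProbabilityMeasure ℝ, SubGaussian σ f₀ →
      (lawNoChange f₀).real {x | D.alarmTime x ≤ (T : ℕ∞)} ≤ δ) :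
    E.law.real {ω | ∃ j < E.ν k - 1 - s, virtAlarm feed B D α s k ω j} ≤ A * δ := by
  have h1 := E.ν_le_succ hk
  have h2 := E.one_le_ν hk
  have h3 := E.one_le_ν (i := k - 1) (by omega)
  refine DAB.prob_false_alarm_le feed B D α s k (fun t => E.F (E.interval t)) (H := T) (by omega)
    (E.F k) (fun j hj => ?_) fun a => hF _ (E.subGaussian k hk1 hk a)
  rw [E.interval_eq hk1 hk (by omega) (by omega)]

lemma PSBandit.exists_changed_arm [Nonempty (Fin A)] {k : ℕ} (hk1 : 1 ≤ k) (hk : k ≤ E.N) :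
    ∃ a, Δ ≤ |mean (E.F k a) - mean (E.F (k + 1) a)| := by
  obtain ⟨a, ha⟩ := exists_eq_ciSup_of_finite
    (f := fun a : Fin A => |mean (E.F (k + 1) a) - mean (E.F k a)|)
  refine ⟨a, ?_⟩
  rw [abs_sub_comm]
  exact (E.le_changeGap k hk1 hk).trans ha.ge

lemma PSBandit.prob_miss_le {k s : ℕ} (hA : 2 ≤ A) (hk1 : 1 ≤ k) (hk : k ≤ E.N)
    (hL : A ≤ ⌈(A : ℝ) / α k⌉₊) (hd : 1 ≤ d) (hδ : 0 ≤ δ)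
    (hD : ∀ f₀ f₁ : ProbabilityMeasure ℝ, SubGaussian σ f₀ → SubGaussian σ f₁ →
      Δ ≤ |mean f₀ - mean f₁| → ∀ ν : ℕ, m + 1 ≤ ν → ν ≤ T - d →
        (lawChange f₀ f₁ ν).real {x | ((ν + d : ℕ) : ℕ∞) ≤ D.alarmTime x} ≤ δ)
    (hsep : E.Separated α m d) (hend : E.ν k + window A α d k ≤ E.ν (k + 1))
    (hs1 : E.ν (k - 1) - 1 ≤ s) (hs2 : s ≤ E.ν (k - 1) - 1 + window A α d (k - 1)) :
    E.law.real {ω | ¬ ∃ j < E.ν k - 1 - s + window A α d k, virtAlarm feed B D α s k ω j}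
      ≤ feedFactor T feed * δ := by
  have : Nonempty (Fin A) := ⟨B.act [] 0⟩
  obtain ⟨a, ha⟩ := E.exists_changed_arm hk1 hk
  have hw : ∀ n, window A α n k = ⌈(A : ℝ) / α k⌉₊ * n := fun n => if_neg (by omega)
  have hsepk := hsep k hk1 hk
  rw [hw m] at hsepk
  rw [hw d] at hend ⊢
  have h1 := E.ν_le_succ (i := k + 1) (by omega)
  have h2 := E.one_le_ν (i := k) (by omega)
  have h3 := E.one_le_ν (i := k - 1) (by omega)
  have h4 : 2 * d ≤ ⌈(A : ℝ) / α k⌉₊ * d := Nat.mul_le_mul_right _ (hA.trans hL)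
  have h5 := E.ν_lt (k - 1) (by omega)
  rw [show k - 1 + 1 = k by omega] at h5
  refine DAB.prob_miss_le feed B D α s k (fun t => E.F (E.interval t)) (m := m) (H := T) a
    (E.F k a) (E.F (k + 1) a) hL (by omega) (by omega) (fun j hj => ?_) (fun j hj1 hj2 => ?_) hδ
    (hD _ _ (E.subGaussian k hk1 (by omega) a) (E.subGaussian (k + 1) (by omega) (by omega) a) ha)
  · rw [E.interval_eq hk1 (by omega) (by omega) (by omega)]
  · rw [E.interval_eq (k := k + 1) (by omega) (by omega) (by rw [Nat.add_sub_cancel]; omega)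
      (by omega)]

/-- The probability of not entering the `k`-th interval in time grows linearly with `k`. -/
lemma PSBandit.prob_not_restartIn_le (hA : 2 ≤ A)
    (hL : ∀ k, 1 ≤ k → k ≤ E.N → A ≤ ⌈(A : ℝ) / α k⌉₊) (hd : 1 ≤ d) (hδ : 0 ≤ δ)
    (hF : ∀ f₀ : ProbabilityMeasure ℝ, SubGaussian σ f₀ →
      (lawNoChange f₀).real {x | D.alarmTime x ≤ (T : ℕ∞)} ≤ δ)
    (hD : ∀ f₀ f₁ : ProbabilityMeasure ℝ, SubGaussian σ f₀ → SubGaussian σ f₁ →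
      Δ ≤ |mean f₀ - mean f₁| → ∀ ν : ℕ, m + 1 ≤ ν → ν ≤ T - d →
        (lawChange f₀ f₁ ν).real {x | ((ν + d : ℕ) : ℕ∞) ≤ D.alarmTime x} ≤ δ)
    (hsep : E.Separated α m d) (k : ℕ) (hk : k ≤ E.N)
    (hend : E.ν k + window A α d k ≤ E.ν (k + 1)) :
    E.law.real (restartIn feed B D α (k + 1) (E.ν k - 1) (E.ν k - 1 + window A α d k))ᶜ
      ≤ k * (A * δ + feedFactor T feed * δ) := by
  induction k with
  | zero =>
    have : (restartIn feed B D α (0 + 1) (E.ν 0 - 1) (E.ν 0 - 1 + window A α d 0)) = Set.univ := by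
      refine Set.eq_univ_of_forall fun ω => ⟨0, ?_, rfl⟩
      simp [E.ν_zero]
    rw [this]
    simp
  | succ k ih =>
    have hsepk := hsep (k + 1) (by omega) hk
    rw [Nat.add_sub_cancel] at hsepk
    have hlt := E.ν_lt k (by omega)
    have h3 := E.one_le_ν (i := k) (by omega)
    have hend' : E.ν k + window A α d k ≤ E.ν (k + 1) := by omega
    have ih' := ih (by omega) hend'
    have := prob_not_restartIn_succ_le feed B D α (fun t => E.F (E.interval t)) (k + 1)
      (E.ν k - 1) (E.ν k - 1 + window A α d k) (E.ν (k + 1) - 1) (window A α d (k + 1)) (by omega)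
      (p := A * δ) (q := feedFactor T feed * δ) (by positivity) (by positivity)
      (fun s hs => E.prob_false_alarm_le feed B D α (by omega) (by omega)
        (by simpa using (Finset.mem_Icc.1 hs).1) hF)
      (fun s hs => E.prob_miss_le feed B D α hA (by omega) hk (hL _ (by omega) hk) hd hδ hD hsep
        hend (by simpa using (Finset.mem_Icc.1 hs).1) (by simpa using (Finset.mem_Icc.1 hs).2))
    refine this.trans ?_
    push_cast
    have ih'' : (Measure.infinitePi fun t => roundLaw (E.F (E.interval t))).real
        (restartIn feed B D α (k + 1) (E.ν k - 1) (E.ν k - 1 + window A α d k))ᶜ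
          ≤ k * (A * δ + feedFactor T feed * δ) := ih'
    linarith

lemma regret_le_of_hasMinimaxRate {K : ℝ} {B : BanditAlg A} (hB : B.HasMinimaxRate σ C K)
    (hT : 2 ≤ T) {f : Fin A → ProbabilityMeasure ℝ} (hf : ∀ a, SubGaussian σ (f a))
    (hC : ∀ a, gap f a ≤ C) {n l : ℕ} (hnl : n ≤ l) (hl1 : 1 ≤ l) (hlT : l ≤ T) :
    B.regret f n ≤ |K| * √((A : ℝ) * (2 * l) * Real.log T) := by
  have h1 : B.regret f n ≤ B.regret f (max l 2) := regret_mono B f (hnl.trans (le_max_left _ _))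
  have h2 : ((max l 2 : ℕ) : ℝ) ≤ 2 * l := by exact_mod_cast (by omega)
  have h3 : ((max l 2 : ℕ) : ℝ) ≤ T := by exact_mod_cast (by omega)
  have h4 : (1 : ℝ) ≤ (max l 2 : ℕ) := by exact_mod_cast (by omega)
  have h5 : Real.log (max l 2 : ℕ) ≤ Real.log T := Real.log_le_log (by linarith) h3
  have h6 : 0 ≤ Real.log (max l 2 : ℕ) := Real.log_nonneg h4
  refine h1.trans ((hB f hf hC _ (le_max_right _ _)).trans ?_)
  refine mul_le_mul (le_abs_self K) (Real.sqrt_le_sqrt ?_) (Real.sqrt_nonneg _) (abs_nonneg K)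
  gcongr

/-- Expected cost of the `k + 1`-st interval. -/
lemma PSBandit.integral_interval_le {KB : ℝ} (hB : B.HasMinimaxRate σ C KB) (hT : 2 ≤ T)
    (hA : 2 ≤ A) (hL : ∀ k, 1 ≤ k → k ≤ E.N + 1 → A ≤ ⌈(A : ℝ) / α k⌉₊) (hd : 1 ≤ d) (hδ : 0 ≤ δ)
    (hF : ∀ f₀ : ProbabilityMeasure ℝ, SubGaussian σ f₀ →
      (lawNoChange f₀).real {x | D.alarmTime x ≤ (T : ℕ∞)} ≤ δ)
    (hD : ∀ f₀ f₁ : ProbabilityMeasure ℝ, SubGaussian σ f₀ → SubGaussian σ f₁ →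
      Δ ≤ |mean f₀ - mean f₁| → ∀ ν : ℕ, m + 1 ≤ ν → ν ≤ T - d →
        (lawChange f₀ f₁ ν).real {x | ((ν + d : ℕ) : ℕ∞) ≤ D.alarmTime x} ≤ δ)
    (hsep : E.Separated α m d) (k : ℕ) (hk : k ≤ E.N) :
    ∫ ω, ∑ t ∈ Finset.Ico (E.ν k) (E.ν (k + 1)),
        gap (E.F (k + 1)) (playedArm feed B D α ω t) ∂E.law
      ≤ C * window A α d k
        + C * (E.ν (k + 1) - E.ν k : ℕ) * ((k + 1) * (A * δ + feedFactor T feed * δ))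
        + (C * (A * ((E.ν (k + 1) - E.ν k : ℕ) / ⌈(A : ℝ) / α (k + 1)⌉₊ + 1))
          + |KB| * √((A : ℝ) * (2 * (E.ν (k + 1) - E.ν k : ℕ)) * Real.log T)) := by
  have hk1 : 1 ≤ k + 1 := by omega
  have hkN : k + 1 ≤ E.N + 1 := by omega
  have hC := E.gap_le (k + 1) hk1 hkN
  have hC0 : 0 ≤ C := (gap_nonneg _ (B.act [] 0)).trans (hC (B.act [] 0))
  have h1 := E.ν_le_succ hkN
  have h2 := E.one_le_ν (i := k) (by omega)
  have h3 := E.ν_lt k hk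
  have hLk := hL (k + 1) hk1 hkN
  by_cases hend : E.ν k + window A α d k ≤ E.ν (k + 1)
  · have hG := E.prob_not_restartIn_le feed B D α hA (fun k h h' => hL k h (by omega)) hd hδ hF hD
      hsep k hk hend
    have key := DAB.integral_interval_le feed B D α (fun t => E.F (E.interval t)) (E.F (k + 1)) hC
      (k + 1) (E.ν k) (window A α d k) (E.ν (k + 1) - 1) (p := A * δ)
      (V := C * (A * ((E.ν (k + 1) - E.ν k : ℕ) / ⌈(A : ℝ) / α (k + 1)⌉₊ + 1))
          + |KB| * √((A : ℝ) * (2 * (E.ν (k + 1) - E.ν k : ℕ)) * Real.log T))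
      (by positivity) (by positivity) h2
      (fun s hs => E.prob_false_alarm_le feed B D α hk1 hkN
        (by simpa using (Finset.mem_Icc.1 hs).1) hF)
      (fun s hs => by
        have hs1 := (Finset.mem_Icc.1 hs).1
        have hn : E.ν (k + 1) - 1 - s ≤ E.ν (k + 1) - E.ν k := by omega
        refine (integral_sum_gap_virtArm_le feed B α s (k + 1) (fun t => E.F (E.interval t))
          (E.F (k + 1)) (fun j hj => ?_) hC (by omega)).trans (add_le_add ?_ ?_)
        · rw [E.interval_eq hk1 hkN (by simp only [Nat.add_sub_cancel]; omega) (by omega)]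
        · gcongr
          push_cast
          gcongr
          refine Nat.cast_div_le.trans ?_
          gcongr
        · exact regret_le_of_hasMinimaxRate hB hT (E.subGaussian _ hk1 hkN) hC hn (by omega)
            (by omega))
    rw [show E.ν (k + 1) - 1 + 1 = E.ν (k + 1) by omega] at key
    refine key.trans ?_
    have hG' : (Measure.infinitePi fun t => roundLaw (E.F (E.interval t))).real
        (restartIn feed B D α (k + 1) (E.ν k - 1) (E.ν k - 1 + window A α d k))ᶜ + A * δ
        ≤ (k + 1) * (A * δ + feedFactor T feed * δ) := by
      have hq : 0 ≤ feedFactor T feed * δ := by positivity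
      have hG'' : (Measure.infinitePi fun t => roundLaw (E.F (E.interval t))).real
        (restartIn feed B D α (k + 1) (E.ν k - 1) (E.ν k - 1 + window A α d k))ᶜ
        ≤ k * (A * δ + feedFactor T feed * δ) := hG
      linarith
    gcongr
  · -- In a last interval shorter than the delay, every round is charged to the delay.
    have hall : ∫ ω, ∑ t ∈ Finset.Ico (E.ν k) (E.ν (k + 1)),
        gap (E.F (k + 1)) (playedArm feed B D α ω t) ∂E.law ≤ C * window A α d k := by
      have hprob : IsProbabilityMeasure E.law := by unfold PSBandit.law; infer_instance
      refine (integral_mono (integrable_finsetSum _ fun t _ =>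
        integrable_gap_comp _ _ (measurable_playedArm feed B D α t))
        (integrable_const (C * window A α d k)) fun ω => ?_).trans (by simp)
      refine (Finset.sum_le_card_nsmul _ _ C fun t _ => hC _).trans ?_
      rw [Nat.card_Ico, nsmul_eq_mul, mul_comm]
      gcongr
      omega
    refine hall.trans ?_
    rw [add_assoc]
    refine le_add_of_nonneg_right ?_
    positivity

end Environment

/-! ### Summation over the intervals -/

section Sums

lemma sum_inv_sqrt_le (n : ℕ) :
    ∑ i ∈ Finset.range (n + 1), (√(i : ℝ))⁻¹ ≤ 2 * √(n : ℝ) := by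
  induction n with
  | zero => simp
  | succ n ih =>
    rw [Finset.sum_range_succ]
    have h1 : 0 < √((n + 1 : ℕ) : ℝ) := Real.sqrt_pos.2 (by positivity)
    have h2 : √(n : ℝ) ≤ √((n + 1 : ℕ) : ℝ) := Real.sqrt_le_sqrt (by push_cast; linarith)
    have h3 : √((n + 1 : ℕ) : ℝ) ^ 2 = n + 1 := by
      rw [Real.sq_sqrt (by positivity)]; push_cast; ring
    have h4 : √(n : ℝ) ^ 2 = n := Real.sq_sqrt (by positivity)
    have h5 : (√((n + 1 : ℕ) : ℝ))⁻¹ ≤ 2 * (√((n + 1 : ℕ) : ℝ) - √(n : ℝ)) := by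
      rw [inv_le_iff_one_le_mul₀ h1]
      nlinarith [Real.sqrt_nonneg (n : ℝ)]
    linarith

lemma sum_sqrt_le {n : ℕ} (f : ℕ → ℝ) (hf : ∀ i, 0 ≤ f i) :
    ∑ i ∈ Finset.range n, √(f i) ≤ √(n * ∑ i ∈ Finset.range n, f i) := by
  refine Real.le_sqrt_of_sq_le ((sq_sum_le_card_mul_sum_sq).trans ?_)
  simp [Real.sq_sqrt (hf _)]

end Sums

section Assembly

variable {A T : ℕ} {σ : ℝ≥0} {C Δ : ℝ} (E : PSBandit A T σ C Δ)

lemma PSBandit.sum_length :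
    ∑ i ∈ Finset.range (E.N + 1), (E.ν (i + 1) - E.ν i) = T := by
  have : ∀ n ≤ E.N + 1, ∑ i ∈ Finset.range n, (E.ν (i + 1) - E.ν i) = E.ν n - 1 := by
    intro n
    induction n with
    | zero => intro _; simp [E.ν_zero]
    | succ n ih =>
      intro hn
      rw [Finset.sum_range_succ, ih (by omega)]
      have h1 := E.ν_lt n (by omega)
      have h2 := E.one_le_ν (i := n) (by omega)
      omega
  rw [this _ le_rfl, E.ν_last]
  rfl

variable (feed : DetectorFeed) (B : BanditAlg A) (D : DetectionRule) (α : ℕ → ℝ)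

lemma regret_eq_sum :
    regret E feed B D α = ∑ i ∈ Finset.range (E.N + 1),
      ∫ ω, ∑ t ∈ Finset.Ico (E.ν i) (E.ν (i + 1)),
        gap (E.F (i + 1)) (playedArm feed B D α ω t) ∂E.law := by
  have hprob : IsProbabilityMeasure E.law := by unfold PSBandit.law; infer_instance
  unfold regret
  rw [integral_finsetSum _ fun k _ => integrable_finsetSum _ fun t _ =>
    integrable_gap_comp _ _ (measurable_playedArm feed B D α t)]
  rw [show Finset.Icc 1 (E.N + 1) = Finset.Ico (0 + 1) (E.N + 1 + 1) by ext; simp,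
    Finset.range_eq_Ico]
  exact (Finset.sum_Ico_add' (fun k => ∫ ω, ∑ t ∈ Finset.Ico (E.ν (k - 1)) (E.ν k),
    gap (E.F k) (playedArm feed B D α ω t) ∂E.law) 0 (E.N + 1) 1).symm

lemma regret_le_mul_horizon : regret E feed B D α ≤ C * T := by
  have hprob : IsProbabilityMeasure E.law := by unfold PSBandit.law; infer_instance
  rw [regret_eq_sum]
  have h : ∀ i ∈ Finset.range (E.N + 1),
      ∫ ω, ∑ t ∈ Finset.Ico (E.ν i) (E.ν (i + 1)),
        gap (E.F (i + 1)) (playedArm feed B D α ω t) ∂E.law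
        ≤ C * (E.ν (i + 1) - E.ν i : ℕ) := by
    intro i hi
    have hi' := Finset.mem_range.1 hi
    refine (integral_mono (integrable_finsetSum _ fun t _ =>
      integrable_gap_comp _ _ (measurable_playedArm feed B D α t))
      (integrable_const (C * (E.ν (i + 1) - E.ν i : ℕ))) fun ω => ?_).trans (by simp)
    refine (Finset.sum_le_card_nsmul _ _ C
      fun t _ => E.gap_le (i + 1) (by omega) (by omega) _).trans ?_
    rw [Nat.card_Ico, nsmul_eq_mul, mul_comm]
  refine (Finset.sum_le_sum h).trans ?_
  rw [← Finset.mul_sum, ← Nat.cast_sum, E.sum_length]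

lemma gap_eq_zero_of_subsingleton [Subsingleton (Fin A)] (F : Fin A → ProbabilityMeasure ℝ)
    (a : Fin A) : gap F a = 0 := by
  have : Nonempty (Fin A) := ⟨a⟩
  unfold gap
  rw [show (fun b => mean (F b)) = fun _ => mean (F a) by
    funext b; rw [Subsingleton.elim b a], ciSup_const, sub_self]

lemma regret_eq_zero_of_subsingleton [Subsingleton (Fin A)] : regret E feed B D α = 0 := by
  simp [regret, gap_eq_zero_of_subsingleton]

end Assembly

/-! ### Consequences of the requirements on the detector -/

section Detector

variable {D : ChangeDetector} {σ : ℝ≥0} {m d : ℝ → ℕ → ℝ → ℝ → ℕ} {K : ℝ → ℝ}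

lemma DetectionRule.latency_spec (D : DetectionRule) (σ : ℝ≥0) (Δ : ℝ) {M : ℕ} (m : ℕ) (δD : ℝ)
    (hM : 1 ≤ M) : 1 ≤ D.latency σ Δ M m δD ∧ D.latency σ Δ M m δD ≤ M ∧
    ∀ f₀ f₁ : ProbabilityMeasure ℝ, SubGaussian σ f₀ → SubGaussian σ f₁ →
      |mean f₀ - mean f₁| = Δ →
      ∀ ν : ℕ, m + 1 ≤ ν → ν ≤ M - D.latency σ Δ M m δD →
        (lawChange f₀ f₁ ν).real
          {x | ((ν + D.latency σ Δ M m δD : ℕ) : ℕ∞) ≤ D.alarmTime x} ≤ δD := by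
  unfold latency
  refine Nat.sInf_mem (s := {t : ℕ | 1 ≤ t ∧ t ≤ M ∧
    ∀ f₀ f₁ : ProbabilityMeasure ℝ, SubGaussian σ f₀ → SubGaussian σ f₁ →
      |mean f₀ - mean f₁| = Δ →
      ∀ ν : ℕ, m + 1 ≤ ν → ν ≤ M - t →
        (lawChange f₀ f₁ ν).real {x | ((ν + t : ℕ) : ℕ∞) ≤ D.alarmTime x} ≤ δD}) ?_
  -- For the largest admissible value no change-point has to be considered.
  exact ⟨M, hM, le_rfl, fun f₀ f₁ _ _ _ ν h1 h2 => by omega⟩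

variable {Δ : ℝ} {M : ℕ} {δF δD : ℝ}

lemma ChangeDetector.Good.one_le (hD : D.Good σ m d K) (hΔ : 0 < Δ) (hM : 2 ≤ M) (hF : δF ∈ Set.Ioo (0 : ℝ) 1)
    (hδD : δD ∈ Set.Ioo (0 : ℝ) 1) : 1 ≤ d Δ M δF δD :=
  ((D M δF δD).latency_spec σ Δ (m Δ M δF δD) δD (by omega)).1.trans
    (hD.latency_le Δ M δF δD hΔ hM hF hδD)

/-- Larger mean shifts than `Δ` are detected within the latency bound for `Δ`. -/
lemma ChangeDetector.Good.prob_late_le (hD : D.Good σ m d K) (hΔ : 0 < Δ) (hM : 2 ≤ M)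
    (hF : δF ∈ Set.Ioo (0 : ℝ) 1)
    (hδD : δD ∈ Set.Ioo (0 : ℝ) 1) {f₀ f₁ : ProbabilityMeasure ℝ} (h₀ : SubGaussian σ f₀)
    (h₁ : SubGaussian σ f₁) (hs : Δ ≤ |mean f₀ - mean f₁|) {ν : ℕ} (hν : m Δ M δF δD + 1 ≤ ν)
    (hν' : ν ≤ M - d Δ M δF δD) :
    (lawChange f₀ f₁ ν).real
      {x | ((ν + d Δ M δF δD : ℕ) : ℕ∞) ≤ (D M δF δD).alarmTime x} ≤ δD := by
  set Δ' := |mean f₀ - mean f₁|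
  have hmono := hD.anti_shift Δ Δ' M δF δD hΔ hs hM hF hδD
  have hlat := (hD.latency_le Δ' M δF δD (hΔ.trans_le hs) hM hF hδD).trans hmono.2
  have hspec := ((D M δF δD).latency_spec σ Δ' (M := M) (m Δ' M δF δD) δD (by omega)).2.2 f₀ f₁ h₀ h₁
    rfl ν (by omega) (by omega)
  have hprob : IsProbabilityMeasure (lawChange f₀ f₁ ν) := by
    unfold lawChange; infer_instance
  refine le_trans (measureReal_mono fun x hx => ?_) hspec
  simp only [Set.mem_ofPred_eq] at hx ⊢
  refine le_trans ?_ hx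
  exact_mod_cast (by omega)

end Detector

/-! ### The order of the regret -/

section Order

lemma quarter_le_log {T : ℕ} (hT : 2 ≤ T) : 1 / 4 ≤ Real.log T := by
  have h1 : Real.log 2 ≤ Real.log T := Real.log_le_log (by norm_num) (by exact_mod_cast hT)
  have h2 := Real.log_two_gt_d9
  linarith

lemma mul_le_two_mul_sqrt {x T ℓ : ℝ} (hx : 0 ≤ x) (hxT : x ≤ T) (hℓ : 1 / 4 ≤ ℓ) :
    x ≤ 2 * √(x * T * ℓ) := by
  have h : (x / 2) ^ 2 ≤ x * T * ℓ := by
    have h1 : x * x ≤ x * T := mul_le_mul_of_nonneg_left hxT hx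
    have h2 : 0 ≤ x * T := mul_nonneg hx (hx.trans hxT)
    nlinarith
  have := Real.le_sqrt_of_sq_le h
  linarith

lemma horizon_mul_level_le {T A : ℕ} (hT : 2 ≤ T) {γ : ℝ} (hγ : 1 < γ) (feed : DetectorFeed)
    (hfeed : feed = DetectorFeed.allSamples → 2 ≤ γ) :
    (T : ℝ) * (A * (T : ℝ) ^ (-γ) + feedFactor T feed * (T : ℝ) ^ (-γ)) ≤ A + 1 := by
  have hT1 : (1 : ℝ) ≤ T := by exact_mod_cast (by omega)
  have hT0 : (0 : ℝ) < T := by linarith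
  have h1 : (T : ℝ) * (T : ℝ) ^ (-γ) ≤ 1 := by
    rw [← Real.rpow_one_add' hT0.le (by linarith)]
    exact Real.rpow_le_one_of_one_le_of_nonpos hT1 (by linarith)
  have hA : (0 : ℝ) ≤ A := Nat.cast_nonneg A
  cases feed with
  | forcedOnly =>
    simp only [feedFactor, Nat.cast_one, one_mul]
    nlinarith
  | allSamples =>
    have h2 : (T : ℝ) * ((T : ℝ) * (T : ℝ) ^ (-γ)) ≤ 1 := by
      have hγ2 := hfeed rfl
      rw [← Real.rpow_one_add' hT0.le (by linarith)]
      have e : (T : ℝ) * (T : ℝ) ^ (1 + -γ) = (T : ℝ) ^ (2 - γ) := by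
        have : (T : ℝ) * (T : ℝ) ^ (1 + -γ) = (T : ℝ) ^ (1 : ℝ) * (T : ℝ) ^ (1 + -γ) := by
          rw [Real.rpow_one]
        rw [this, ← Real.rpow_add hT0]
        congr 1
        ring
      rw [e]
      exact Real.rpow_le_one_of_one_le_of_nonpos hT1 (by linarith)
    simp only [feedFactor]
    nlinarith

end Order

/-! ### The rate -/

section Rate

variable {A T : ℕ} {α₀ : ℝ}

lemma explorationFreq_mono (hα₀ : 0 ≤ α₀) {i j : ℕ} (hij : i ≤ j) :
    explorationFreq α₀ A T i ≤ explorationFreq α₀ A T j := by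
  have hℓ : 0 ≤ Real.log T := Real.log_natCast_nonneg T
  unfold explorationFreq
  gcongr

lemma explorationFreq_pos (hα₀ : 0 < α₀) (hA : 1 ≤ A) (hT : 2 ≤ T) {k : ℕ} (hk : 1 ≤ k) :
    0 < explorationFreq α₀ A T k := by
  have hℓ : 0 < Real.log T := by linarith [quarter_le_log hT]
  have hk' : (0 : ℝ) < k := by exact_mod_cast hk
  have hA' : (0 : ℝ) < A := by exact_mod_cast hA
  have hT' : (0 : ℝ) < T := by exact_mod_cast (by omega)
  unfold explorationFreq
  positivity

/-- The total forced exploration at the last frequency is of the order of the regret bound. -/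
lemma horizon_mul_explorationFreq_le (hα₀ : 0 ≤ α₀) (hT : 2 ≤ T) {N : ℕ} (hN : 1 ≤ N) :
    T * explorationFreq α₀ A T (N + 1) ≤ 2 * α₀ * √((A : ℝ) * N * T * Real.log T) := by
  have hℓ : 0 ≤ Real.log T := Real.log_natCast_nonneg T
  have hT' : (0 : ℝ) < T := by exact_mod_cast (by omega)
  have hN' : (1 : ℝ) ≤ N := by exact_mod_cast hN
  have h1 : T * √(((N + 1 : ℕ) : ℝ) * A * Real.log T / T) ≤ 2 * √((A : ℝ) * N * T * Real.log T) := by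
    have e1 : (T : ℝ) = √((T : ℝ) ^ 2) := (Real.sqrt_sq hT'.le).symm
    have e2 : (2 : ℝ) = √(2 ^ 2) := (Real.sqrt_sq (by norm_num)).symm
    nth_rewrite 1 [e1]
    rw [e2, ← Real.sqrt_mul (by positivity), ← Real.sqrt_mul (by positivity)]
    refine Real.sqrt_le_sqrt ?_
    have e3 : (T : ℝ) ^ 2 * (((N + 1 : ℕ) : ℝ) * A * Real.log T / T)
        = (N + 1 : ℝ) * (A * T * Real.log T) := by
      push_cast
      field_simp
    rw [e3]
    have h2 : 0 ≤ (A : ℝ) * T * Real.log T := by positivity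
    nlinarith
  unfold explorationFreq
  calc T * (α₀ * √(((N + 1 : ℕ) : ℝ) * A * Real.log T / T))
      = α₀ * (T * √(((N + 1 : ℕ) : ℝ) * A * Real.log T / T)) := by ring
    _ ≤ α₀ * (2 * √((A : ℝ) * N * T * Real.log T)) := mul_le_mul_of_nonneg_left h1 hα₀
    _ = _ := by ring

/-- The total delay of the procedure. -/
lemma sum_window_le (hα₀ : 0 < α₀) (hA : 1 ≤ A) (hT : 2 ≤ T) (N d : ℕ) :
    (∑ i ∈ Finset.range (N + 1), (window A (explorationFreq α₀ A T) d i : ℝ))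
      ≤ d * (2 / α₀ * √((A : ℝ) * N * T / Real.log T) + N) := by
  have hℓ : 0 < Real.log T := by linarith [quarter_le_log hT]
  have hA' : (0 : ℝ) < A := by exact_mod_cast hA
  have hT' : (0 : ℝ) < T := by exact_mod_cast (by omega)
  set r := √((A : ℝ) * T / Real.log T) with hr
  -- The case `i = 0` conforms to the convention of the latency being zero, as `(√0)⁻¹ = 0`.
  have h1 : ∀ i ∈ Finset.range (N + 1), (window A (explorationFreq α₀ A T) d i : ℝ)
      ≤ d * (r / α₀ * (√(i : ℝ))⁻¹ + if i = 0 then 0 else 1) := by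
    intro i _
    unfold window
    by_cases hi : i = 0
    · simp [hi]
    · rw [if_neg hi, if_neg hi]
      have hi' : (0 : ℝ) < i := by exact_mod_cast Nat.pos_of_ne_zero hi
      push_cast
      rw [mul_comm]
      gcongr
      refine (Nat.ceil_lt_add_one ?_).le.trans (le_of_eq ?_)
      · exact div_nonneg hA'.le (explorationFreq_pos hα₀ hA hT (by omega)).le
      · congr 1
        unfold explorationFreq
        have e : √((i : ℝ) * A * Real.log T / T) * r = √(i : ℝ) * A := by
          rw [hr, ← Real.sqrt_mul (by positivity)]
          rw [show (i : ℝ) * A * Real.log T / T * (A * T / Real.log T) = i * A ^ 2 by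
            field_simp]
          rw [Real.sqrt_mul (by positivity), Real.sqrt_sq hA'.le]
        have hpos1 : 0 < √((i : ℝ) * A * Real.log T / T) := Real.sqrt_pos.2 (by positivity)
        have hpos2 : 0 < √(i : ℝ) := Real.sqrt_pos.2 hi'
        have e' : r = √(i : ℝ) * A / √((i : ℝ) * A * Real.log T / T) := by
          rw [eq_div_iff hpos1.ne']
          linarith
        rw [e']
        generalize √((i : ℝ) * A * Real.log T / T) = u at hpos1
        field_simp
  refine (Finset.sum_le_sum h1).trans ?_
  rw [← Finset.mul_sum, Finset.sum_add_distrib, ← Finset.mul_sum]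
  have h2 := sum_inv_sqrt_le N
  have h3 : (∑ i ∈ Finset.range (N + 1), (if i = 0 then (0 : ℝ) else 1)) = N := by
    rw [Finset.sum_range_succ']
    simp
  have h4 : √((A : ℝ) * N * T / Real.log T) = r * √(N : ℝ) := by
    rw [hr, ← Real.sqrt_mul (by positivity)]
    congr 1
    ring
  rw [h3, h4]
  refine mul_le_mul_of_nonneg_left (add_le_add ?_ le_rfl) (Nat.cast_nonneg d)
  calc r / α₀ * ∑ i ∈ Finset.range (N + 1), (√(i : ℝ))⁻¹ ≤ r / α₀ * (2 * √(N : ℝ)) := by gcongr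
    _ = 2 / α₀ * (r * √(N : ℝ)) := by ring

lemma delay_le_rate (hα₀ : 0 < α₀) (hT : 2 ≤ T) (hA : 1 ≤ A) {N : ℕ} {d κ : ℝ}
    (hκ : 0 ≤ κ) (hd : d ≤ κ * Real.log T) (hN : N * Real.log T ≤ T) :
    d * (2 / α₀ * √((A : ℝ) * N * T / Real.log T) + N)
      ≤ κ * (2 / α₀ + 1) * √((A : ℝ) * N * T * Real.log T) := by
  have hℓ : 0 < Real.log T := by linarith [quarter_le_log hT]
  have hA' : (1 : ℝ) ≤ A := by exact_mod_cast hA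
  have hT' : (0 : ℝ) < T := by exact_mod_cast (by omega)
  have h1 : Real.log T * √((A : ℝ) * N * T / Real.log T) = √((A : ℝ) * N * T * Real.log T) := by
    have e1 : Real.log T = √(Real.log T ^ 2) := (Real.sqrt_sq hℓ.le).symm
    nth_rewrite 1 [e1]
    rw [← Real.sqrt_mul (by positivity)]
    congr 1
    field_simp
  have h2 : N * Real.log T ≤ √((A : ℝ) * N * T * Real.log T) := by
    refine Real.le_sqrt_of_sq_le ?_
    have h3 : 0 ≤ N * Real.log T := by positivity
    calc (N * Real.log T) ^ 2 = (N * Real.log T) * (N * Real.log T) := by ring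
      _ ≤ (A * (N * Real.log T)) * T := by
          refine mul_le_mul ?_ hN h3 (by positivity)
          nlinarith
      _ = _ := by ring
  calc d * (2 / α₀ * √((A : ℝ) * N * T / Real.log T) + N)
      ≤ (κ * Real.log T) * (2 / α₀ * √((A : ℝ) * N * T / Real.log T) + N) := by gcongr
    _ = κ * (2 / α₀ * (Real.log T * √((A : ℝ) * N * T / Real.log T)) + N * Real.log T) := by ring
    _ ≤ κ * (2 / α₀ * √((A : ℝ) * N * T * Real.log T) + √((A : ℝ) * N * T * Real.log T)) := by
        rw [h1]
        gcongr
    _ = _ := by ring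

end Rate

section Main

variable {A T : ℕ} {σ : ℝ≥0} {C Δ α₀ : ℝ} (E : PSBandit A T σ C Δ)

/-- Sum of the expected costs of the intervals, when the exploration frequencies are at most one and
there are few arms and change-points compared to the horizon. -/
lemma regret_le_of_explorationFreq_le_one (feed : DetectorFeed) (B : BanditAlg A)
    (D : DetectionRule) {KB : ℝ} (hB : B.HasMinimaxRate σ C KB) (hT : 2 ≤ T) (hA : 2 ≤ A)
    (hα₀ : 0 < α₀) {m d : ℕ} (hd : 1 ≤ d) {δ κ : ℝ} (hδ : 0 ≤ δ) (hκ : 0 ≤ κ)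
    (hF : ∀ f₀ : ProbabilityMeasure ℝ, SubGaussian σ f₀ →
      (lawNoChange f₀).real {x | D.alarmTime x ≤ (T : ℕ∞)} ≤ δ)
    (hD : ∀ f₀ f₁ : ProbabilityMeasure ℝ, SubGaussian σ f₀ → SubGaussian σ f₁ →
      Δ ≤ |mean f₀ - mean f₁| → ∀ ν : ℕ, m + 1 ≤ ν → ν ≤ T - d →
        (lawChange f₀ f₁ ν).real {x | ((ν + d : ℕ) : ℕ∞) ≤ D.alarmTime x} ≤ δ)
    (hsep : E.Separated (explorationFreq α₀ A T) m d) (hN : 1 ≤ E.N)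
    (hlevel : T * (A * δ + feedFactor T feed * δ) ≤ A + 1) (hdκ : d ≤ κ * Real.log T)
    (hAN : (A : ℝ) * E.N ≤ T) (hNT : E.N * Real.log T ≤ T)
    (hα : explorationFreq α₀ A T (E.N + 1) ≤ 1) :
    regret E feed B D (explorationFreq α₀ A T)
      ≤ (C * (κ * (2 / α₀ + 1)) + 8 * C + C * (2 * α₀ + 4) + 2 * |KB|)
        * √((A : ℝ) * E.N * T * Real.log T) := by
  set α := explorationFreq α₀ A T with hαdef
  set S := √((A : ℝ) * E.N * T * Real.log T) with hS
  set N := E.N with hNdef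
  have hℓ4 := quarter_le_log hT
  have hℓ : 0 < Real.log T := by linarith
  have hA' : (2 : ℝ) ≤ A := by exact_mod_cast hA
  have hN' : (1 : ℝ) ≤ N := by exact_mod_cast hN
  have hT' : (0 : ℝ) < T := by exact_mod_cast (by omega)
  have hC0 : 0 ≤ C := (gap_nonneg _ (B.act [] 0)).trans
    (E.gap_le 1 le_rfl (by omega) (B.act [] 0))
  have hαle : ∀ k, k ≤ N + 1 → α k ≤ α (N + 1) := fun k hk => explorationFreq_mono hα₀.le hk
  have hαpos : ∀ k, 1 ≤ k → 0 < α k := fun k hk => explorationFreq_pos hα₀ (by omega) hT hk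
  have hL : ∀ k, 1 ≤ k → k ≤ N + 1 → A ≤ ⌈(A : ℝ) / α k⌉₊ := by
    intro k hk1 hk
    have h1 : (A : ℝ) ≤ A / α k := by
      rw [le_div_iff₀ (hαpos k hk1)]
      have := (hαle k hk).trans hα
      nlinarith
    exact_mod_cast h1.trans (Nat.le_ceil _)
  have hALα : ∀ k, 1 ≤ k → k ≤ N + 1 → (A : ℝ) / ⌈(A : ℝ) / α k⌉₊ ≤ α (N + 1) := by
    intro k hk1 hk
    have h1 : (0 : ℝ) < ⌈(A : ℝ) / α k⌉₊ := by
      have := hL k hk1 hk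
      exact_mod_cast (by omega)
    refine le_trans ?_ (hαle k hk)
    rw [div_le_iff₀ h1, mul_comm, ← div_le_iff₀ (hαpos k hk1)]
    exact Nat.le_ceil _
  let l : ℕ → ℝ := fun i => (E.ν (i + 1) - E.ν i : ℕ)
  have hl0 : ∀ i, 0 ≤ l i := fun i => Nat.cast_nonneg _
  have hlsum : ∑ i ∈ Finset.range (N + 1), l i = T := by
    rw [← Nat.cast_sum, E.sum_length]
  have hANS : (A : ℝ) * N ≤ 2 * S :=
    mul_le_two_mul_sqrt (by positivity) hAN hℓ4
  -- The detection delays sum to the order of the rate since `d` is logarithmic in the horizon.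
  have hdelay : ∑ i ∈ Finset.range (N + 1), C * (window A α d i : ℝ)
      ≤ C * (κ * (2 / α₀ + 1)) * S := by
    rw [← Finset.mul_sum, mul_assoc]
    gcongr
    exact (sum_window_le hα₀ (by omega) hT N d).trans
      (delay_le_rate hα₀ hT (by omega) hκ hdκ hNT)
  -- An exceptional event costs at most the interval, and `T` times its probability is `O(N A)`.
  have hfail : ∑ i ∈ Finset.range (N + 1),
      C * l i * ((i + 1) * (A * δ + feedFactor T feed * δ)) ≤ 8 * C * S := by
    have h0 : 0 ≤ A * δ + feedFactor T feed * δ := by positivity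
    calc ∑ i ∈ Finset.range (N + 1), C * l i * ((i + 1) * (A * δ + feedFactor T feed * δ))
        ≤ ∑ i ∈ Finset.range (N + 1), C * l i * ((N + 1) * (A * δ + feedFactor T feed * δ)) := by
          refine Finset.sum_le_sum fun i hi => ?_
          have : (i : ℝ) ≤ N := by
            have := Finset.mem_range.1 hi
            exact_mod_cast (by omega)
          have := hl0 i
          gcongr
      _ = C * (N + 1) * (T * (A * δ + feedFactor T feed * δ)) := by
          rw [← Finset.sum_mul, ← Finset.mul_sum, hlsum]
          ring
      _ ≤ C * (N + 1) * (A + 1) := by gcongr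
      _ ≤ C * (2 * N * (2 * A)) := by
          rw [mul_assoc]
          gcongr <;> linarith
      _ ≤ 8 * C * S := by nlinarith
  -- Forced exploration takes a fraction `A / L ≤ α_{N+1}` of the rounds, up to one cycle.
  have hforced : ∑ i ∈ Finset.range (N + 1),
      C * (A * (l i / ⌈(A : ℝ) / α (i + 1)⌉₊ + 1)) ≤ C * (2 * α₀ + 4) * S := by
    calc ∑ i ∈ Finset.range (N + 1), C * (A * (l i / ⌈(A : ℝ) / α (i + 1)⌉₊ + 1))
        ≤ ∑ i ∈ Finset.range (N + 1), C * (l i * α (N + 1) + A) := by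
          refine Finset.sum_le_sum fun i hi => ?_
          have h1 := hALα (i + 1) (by omega) (by have := Finset.mem_range.1 hi; omega)
          have e : (A : ℝ) * (l i / ⌈(A : ℝ) / α (i + 1)⌉₊ + 1)
              = l i * (A / ⌈(A : ℝ) / α (i + 1)⌉₊) + A := by ring
          rw [e]
          have := hl0 i
          gcongr
      _ = C * (T * α (N + 1) + (N + 1) * A) := by
          rw [← Finset.mul_sum, Finset.sum_add_distrib, ← Finset.sum_mul, hlsum]
          simp
      _ ≤ C * (2 * α₀ * S + 4 * S) := by
          have h2 : T * α (N + 1) ≤ 2 * α₀ * S := horizon_mul_explorationFreq_le hα₀.le hT hN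
          have h3 : (N + 1 : ℝ) * A ≤ 4 * S := by nlinarith
          gcongr
      _ = _ := by ring
  -- The regrets of the bandit algorithm are summed by the Cauchy-Schwarz inequality.
  have hbandit : ∑ i ∈ Finset.range (N + 1),
      |KB| * √((A : ℝ) * (2 * l i) * Real.log T) ≤ 2 * |KB| * S := by
    rw [← Finset.mul_sum, mul_comm 2 |KB|, mul_assoc]
    refine mul_le_mul_of_nonneg_left ?_ (abs_nonneg KB)
    refine (sum_sqrt_le (fun i => (A : ℝ) * (2 * l i) * Real.log T) fun i => by
      have := hl0 i
      positivity).trans ?_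
    have e2 : (2 : ℝ) = √(2 ^ 2) := (Real.sqrt_sq (by norm_num)).symm
    rw [← Finset.sum_mul, ← Finset.mul_sum, ← Finset.mul_sum, hlsum, hS]
    nth_rewrite 2 [e2]
    rw [← Real.sqrt_mul (by positivity)]
    refine Real.sqrt_le_sqrt ?_
    push_cast
    have h4 : 0 ≤ (A : ℝ) * T * Real.log T := by positivity
    nlinarith
  rw [regret_eq_sum]
  refine (Finset.sum_le_sum fun i hi => E.integral_interval_le feed B D α hB hT hA hL hd hδ hF hD
    hsep i (by have := Finset.mem_range.1 hi; omega)).trans ?_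
  rw [Finset.sum_add_distrib, Finset.sum_add_distrib, Finset.sum_add_distrib]
  have htot := add_le_add (add_le_add hdelay hfail) (add_le_add hforced hbandit)
  refine htot.trans (le_of_eq ?_)
  ring

end Main

end DAB

theorem corollary1 (σ : ℝ≥0) (C Δ α₀ γ KB : ℝ) (KD : ℝ → ℝ) (feed : DAB.DetectorFeed)
    (hΔ : 0 < Δ) (hα₀ : 0 < α₀) (hγ : 1 < γ)
    (hfeed : feed = DAB.DetectorFeed.allSamples → 2 ≤ γ) :
    ∃ c : ℝ, 0 < c ∧
      ∀ (A T : ℕ) (B : DAB.BanditAlg A) (D : DAB.ChangeDetector) (m d : ℝ → ℕ → ℝ → ℝ → ℕ)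
        (E : DAB.PSBandit A T σ C Δ),
        2 ≤ T →
        B.HasMinimaxRate σ C KB →
        D.Good σ m d KD →
        1 ≤ E.N →
        E.Separated (DAB.explorationFreq α₀ A T)
          (m Δ T ((T : ℝ) ^ (-γ)) ((T : ℝ) ^ (-γ))) (d Δ T ((T : ℝ) ^ (-γ)) ((T : ℝ) ^ (-γ))) →
        DAB.regret E feed B (D T ((T : ℝ) ^ (-γ)) ((T : ℝ) ^ (-γ))) (DAB.explorationFreq α₀ A T)
          ≤ c * √((A : ℝ) * E.N * T * Real.log T) := by
  have hκ : 0 ≤ |KD Δ| * (1 + 2 * γ) := by positivity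
  refine ⟨|C| * (|KD Δ| * (1 + 2 * γ) * (2 / α₀ + 1)) + 8 * |C| + |C| * (2 * α₀ + 4) + 2 * |KB| + 1,
    by positivity, ?_⟩
  intro A T B D m d E hT hB hD hN hsep
  set δ := (T : ℝ) ^ (-γ) with hδ
  set S := √((A : ℝ) * E.N * T * Real.log T) with hS
  have hS0 : 0 ≤ S := Real.sqrt_nonneg _
  have hT1 : (1 : ℝ) < T := by exact_mod_cast (by omega)
  have hT0 : (0 : ℝ) < T := by linarith
  have hδ1 : δ ∈ Set.Ioo (0 : ℝ) 1 :=
    ⟨Real.rpow_pos_of_pos hT0 _, Real.rpow_lt_one_of_one_lt_of_neg hT1 (by linarith)⟩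
  have hℓ4 := DAB.quarter_le_log hT
  have hN' : (1 : ℝ) ≤ E.N := by exact_mod_cast hN
  have hA0 : 0 < A := Fin.pos (B.act [] 0)
  have hA' : (1 : ℝ) ≤ A := by exact_mod_cast hA0
  have hC0 : 0 ≤ C := (DAB.gap_nonneg _ (B.act [] 0)).trans
    (E.gap_le 1 le_rfl (by omega) (B.act [] 0))
  rw [abs_of_nonneg hC0]
  rcases Nat.lt_or_ge A 2 with hA | hA
  · have hsub : Subsingleton (Fin A) := Fin.subsingleton_iff_le_one.2 (by omega)
    rw [DAB.regret_eq_zero_of_subsingleton]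
    positivity
  by_cases htriv : (T : ℝ) ≤ (2 * α₀ + 4) * S
  · -- The bound is trivial if it exceeds the horizon.
    refine (DAB.regret_le_mul_horizon E feed B _ _).trans ?_
    have h1 : C * T ≤ C * ((2 * α₀ + 4) * S) := mul_le_mul_of_nonneg_left htriv hC0
    refine h1.trans ?_
    rw [← mul_assoc]
    refine mul_le_mul_of_nonneg_right ?_ hS0
    have h2 : 0 ≤ C * (|KD Δ| * (1 + 2 * γ) * (2 / α₀ + 1)) := by positivity
    have h3 := abs_nonneg KB
    linarith
  have hα₀S : 0 ≤ α₀ * S := by positivity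
  have hAN : (A : ℝ) * E.N ≤ T := by
    by_contra hcon
    refine htriv ?_
    have h1 : (T : ℝ) ≤ 2 * √((T : ℝ) * T * Real.log T) :=
      DAB.mul_le_two_mul_sqrt hT0.le le_rfl hℓ4
    have h2 : √((T : ℝ) * T * Real.log T) ≤ S := by
      refine Real.sqrt_le_sqrt ?_
      have := (not_le.1 hcon).le
      gcongr
    linarith
  have hNT : E.N * Real.log T ≤ T := by
    by_contra hcon
    refine htriv ?_
    have h1 : (T : ℝ) ≤ S := by
      refine Real.le_sqrt_of_sq_le ?_
      have h2 := (not_le.1 hcon).le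
      calc (T : ℝ) ^ 2 = 1 * T * T := by ring
        _ ≤ A * T * (E.N * Real.log T) := by gcongr
        _ = _ := by ring
    linarith
  have hα : DAB.explorationFreq α₀ A T (E.N + 1) ≤ 1 := by
    by_contra hcon
    refine htriv ?_
    have h1 := DAB.horizon_mul_explorationFreq_le (A := A) hα₀.le hT hN
    have h2 : (T : ℝ) * 1 ≤ T * DAB.explorationFreq α₀ A T (E.N + 1) := by
      have := (not_le.1 hcon).le
      gcongr
    linarith
  have hlog : Real.log (1 / δ) = γ * Real.log T := by
    rw [one_div, Real.log_inv, hδ, Real.log_rpow hT0]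
    ring
  have hdκ : (d Δ T δ δ : ℝ) ≤ |KD Δ| * (1 + 2 * γ) * Real.log T := by
    have h1 := hD.log_bound Δ T δ δ hΔ hT hδ1 hδ1
    rw [hlog, Nat.cast_add] at h1
    have h2 : KD Δ * (Real.log T + γ * Real.log T + γ * Real.log T)
        ≤ |KD Δ| * (Real.log T + γ * Real.log T + γ * Real.log T) :=
      mul_le_mul_of_nonneg_right (le_abs_self _) (by positivity)
    have h3 : (0 : ℝ) ≤ m Δ T δ δ := Nat.cast_nonneg _
    linarith
  refine (DAB.regret_le_of_explorationFreq_le_one E feed B (D T δ δ) hB hT hA hα₀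
    (hD.one_le hΔ hT hδ1 hδ1) hδ1.1.le hκ (fun f₀ h₀ => hD.false_alarm T δ δ hT hδ1 hδ1 f₀ h₀)
    (fun f₀ f₁ h₀ h₁ hs ν h1 h2 => hD.prob_late_le hΔ hT hδ1 hδ1 h₀ h₁ hs h1 h2) hsep hN
    (DAB.horizon_mul_level_le hT hγ feed hfeed) hdκ hAN hNT hα).trans ?_
  refine mul_le_mul_of_nonneg_right ?_ hS0
  linarith
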